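/- Let $N\ge 1$, let $k>0$ be an even integer, and let $f(z)=\sum_{m\ge1}a(m)e^{2\pi i m z}\in S_k(\Gamma_0(N))$ be a newform (an element of the new subspace that is an eigenform of all Hecke operators, normalized by $a(1)=1$) with real coefficients. Let $\epsilon_f$ be its eigenvalue under the Atkin–Lehner involution $(f|W_N)(z)=N^{-k/2}z^{-k}f(-1/(Nz))$, i.e. $f|W_N=\epsilon_f f$. Let $\Lambda(f,s)=N^{s/2}(2\pi)^{-s}\Gamma(s)L(f,s)$, where $L(f,s)=\sum_{m\ge1}a(m)m^{-s}$ for $\mathrm{Re}(s)>1+\frac k2$, continued to an entire function, and let $\Xi(f,z)=\Lambda(f,\frac k2-iz)$. Then $\epsilon_f\in\{\pm1\}$. For every integer $n\ge1$ the equation $$n=\tfrac12\left(2\pi e^{\frac{L-\log N}{2}}-\tfrac k2+1\right)L$$ has a unique positive solution $L=L(n)$, and $L(n)=2\log\left(\frac{n\sqrt N}{\log(n\sqrt N)}\right)+O(1)$ as $n\to\infty$. There are rational functions $b_1,b_2,\dots\in\mathbb Q(X)$, with $$b_1(X)=\frac{X^4+9X^3+32X^2+24X+16}{24(X+2)^3},$$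 such that, to all orders as $n\to\infty$, $$\Lambda^{(n)}\left(f,\tfrac k2\right)\sim M(n)\left(1+\frac{b_1(L(n))}{n}+\frac{b_2(L(n))}{n^2}+\cdots\right),\qquad \Xi^{(n)}(f,0)\sim(-i)^nM(n)\left(1+\frac{b_1(L(n))}{n}+\frac{b_2(L(n))}{n^2}+\cdots\right),$$ where, with $L=L(n)$, $$M(n)=\frac{\sqrt{2\pi}\,N^{k/4}\,(1+(-1)^n i^k\epsilon_f)}{2^{n+1}}\cdot\frac{L^{n+1}}{\sqrt{\left(1+\frac L2\right)n+\frac14\left(\frac k2-1\right)L^2}}\;e^{\frac k4(L-\log N)-\frac{2n}{L}-\frac k2+1}.$$ Here $F(n)\sim M(n)\bigl(1+\sum_{j\ge1}c_j(n)n^{-j}\bigr)$ to all orders means that for every integer $J\ge0$ and every $\delta>0$, $$F(n)-M(n)\Bigl(1+\sum_{j=1}^{J}\frac{c_j(n)}{n^j}\Bigr)=O\left(|M(n)|\,n^{-(J+1)+\delta}\right)\qquad(n\to\infty).$$ -/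

import Mathlib

open UpperHalfPlane hiding I
open Complex MeasureTheory Filter Asymptotics CongruenceSubgroup
open scoped MatrixGroups Real Modular

namespace ModularAsymptotics

/-- `S_k(Γ₀(N))`. -/
abbrev CuspFormGamma0 (N : ℕ) (k : ℤ) : Type :=
  CuspForm (Gamma0 N : Subgroup (GL (Fin 2) ℝ)) k

/-- The Fourier coefficient `a(n)` in `f(z) = ∑ a(n) e^{2π i n z}`. -/
noncomputable def qCoeff {N : ℕ} {k : ℤ} (f : CuspFormGamma0 N k) (n : ℕ) : ℂ :=
  (qExpansion 1 (f : ℍ → ℂ)).coeff n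

/-- The Petersson inner product on `S_k(Γ₀(N))`, i.e. the integral of
`conj (f τ) * g τ * (im τ)^k` against `dx dy / y²` over a fundamental domain of `Γ₀(N)`. The
fundamental domain is the union of the translates `γ⁻¹ 𝒟` of the standard one of `SL(2, ℤ)`, with
`γ` running over representatives of `SL(2, ℤ) ⧸ Γ₀(N)`. -/
noncomputable def peterssonInner (N : ℕ) (k : ℤ) (f g : ℍ → ℂ) : ℂ :=
  ∑ᶠ q : SL(2, ℤ) ⧸ Gamma0 N, ∫ τ in 𝒟, petersson k f g (q.out⁻¹ • τ)

/-- `f` lies in the new subspace `S_k^new(Γ₀(N))`: it is orthogonal to all old forms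
`τ ↦ g(d τ)`, where `g ∈ S_k(Γ₀(M))`, `d M ∣ N` and `M ≠ N`. -/
def IsNew {N : ℕ} {k : ℤ} (f : CuspFormGamma0 N k) : Prop :=
  ∀ M d : ℕ, d * M ∣ N → M ≠ N → ∀ g : CuspFormGamma0 M k,
    peterssonInner N k (fun τ => g (ofComplex (d * (τ : ℂ)))) f = 0

/-- The `n`-th Fourier coefficient of `T_m f` for the Hecke operator `T_m` of weight `k`, level `N`
and trivial character, where `a` is the sequence of Fourier coefficients of `f`. -/
noncomputable def heckeCoeff (N : ℕ) (k : ℤ) (a : ℕ → ℂ) (m n : ℕ) : ℂ :=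
  ∑ d ∈ (Nat.gcd m n).divisors with d.Coprime N, (d : ℂ) ^ (k - 1) * a (m * n / d ^ 2)

/-- A newform in `S_k(Γ₀(N))`: an element of the new subspace, normalized by `a(1) = 1`, that is an
eigenform of all Hecke operators. -/
structure IsNewform {N : ℕ} {k : ℤ} (f : CuspFormGamma0 N k) : Prop where
  isNew : IsNew f
  normalized : qCoeff f 1 = 1
  eigenform : ∀ m : ℕ, 0 < m →
    ∃ c : ℂ, ∀ n : ℕ, heckeCoeff N k (qCoeff f) m n = c * qCoeff f n

/-- The Atkin–Lehner (Fricke) involution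
`(f | W_N)(τ) = N^{-k/2} τ^{-k} f(-1 / (N τ))`. -/
noncomputable def atkinLehner (N : ℕ) (k : ℤ) (f : ℍ → ℂ) (τ : ℍ) : ℂ :=
  (((N : ℝ) ^ (-(k : ℝ) / 2) : ℝ) : ℂ) * (τ : ℂ) ^ (-k) * f (ofComplex (-1 / (N * (τ : ℂ))))

/-- The completed `L`-function `Λ(f, s) = N^{s/2} (2π)^{-s} Γ(s) L(f, s)`, continued to all of `ℂ`.
Mathlib's `ModularForm.Λ` is the entire function `(2π)^{-s} Γ(s) L(f, s)`; see
`differentiable_completedL` and `completedL_eq`. -/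
noncomputable def completedL {N : ℕ} [NeZero N] {k : ℤ} (hk : 0 < k) (f : CuspFormGamma0 N k)
    (s : ℂ) : ℂ :=
  (N : ℂ) ^ (s / 2) * ModularForm.Λ hk f s

theorem differentiable_completedL {N : ℕ} [NeZero N] {k : ℤ} (hk : 0 < k)
    (f : CuspFormGamma0 N k) : Differentiable ℂ (completedL hk f) := by
  have h := CuspForm.differentiable_Λ hk f
  have hN : (N : ℂ) ≠ 0 := NeZero.ne _
  unfold completedL
  refine Differentiable.mul ?_ h
  exact (differentiable_id.div_const 2).const_cpow (Or.inl hN)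

theorem completedL_eq {N : ℕ} [NeZero N] {k : ℤ} (hk : 0 < k) (f : CuspFormGamma0 N k) {s : ℂ}
    (hs : (k : ℝ) / 2 + 1 < s.re) :
    LSeriesSummable (qCoeff f) s ∧
      completedL hk f s =
        (N : ℂ) ^ (s / 2) * (2 * π : ℂ) ^ (-s) * Gamma s * LSeries (qCoeff f) s := by
  have hk' : (0 : ℝ) < k := by exact_mod_cast hk
  have hs0 : s ≠ 0 := by
    rintro rfl
    simp only [zero_re] at hs
    linarith
  have h := CuspForm.hasSum_Λ f hk hs
  rw [strictWidthInfty_Gamma0 N] at h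
  have h2 : ((2 * π : ℂ)) ^ s ≠ 0 := by
    rw [Ne, cpow_eq_zero_iff]
    simp [Real.pi_ne_zero]
  have hG : Gamma s ≠ 0 := Gamma_ne_zero_of_re_pos (by linarith)
  have hterm : ∀ n : ℕ, (π : ℂ) ^ (-s) * Gamma s * (qExpansion 1 (f : ℍ → ℂ)).coeff n
      / ((2 * n / 1 : ℝ) : ℂ) ^ s
      = ((2 * π : ℂ) ^ (-s) * Gamma s) * LSeries.term (qCoeff f) s n := by
    intro n
    rcases eq_or_ne n 0 with rfl | hn
    · simp [LSeries.term_zero, zero_cpow hs0]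
    · rw [LSeries.term_of_ne_zero hn]
      have e1 : ((2 * n / 1 : ℝ) : ℂ) ^ s = (2 : ℂ) ^ s * (n : ℂ) ^ s := by
        have := mul_cpow_ofReal_nonneg (a := 2) (b := (n : ℝ)) (by norm_num) (by positivity) s
        push_cast at this ⊢
        rw [div_one]
        exact this
      have e2 : (2 * π : ℂ) ^ s = (2 : ℂ) ^ s * (π : ℂ) ^ s := by
        have := mul_cpow_ofReal_nonneg (a := 2) (b := π) (by norm_num) Real.pi_pos.le s
        push_cast at this
        exact this
      rw [e1, cpow_neg, cpow_neg, e2, mul_inv, qCoeff]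
      ring
  have h' : HasSum (fun n => ((2 * π : ℂ) ^ (-s) * Gamma s) * LSeries.term (qCoeff f) s n)
      (ModularForm.Λ hk f s) := by
    convert h using 1
    funext n
    exact (hterm n).symm
  have hc : ((2 * π : ℂ) ^ (-s) * Gamma s) ≠ 0 := by
    rw [cpow_neg]
    exact mul_ne_zero (inv_ne_zero h2) hG
  have hsum : LSeriesSummable (qCoeff f) s := (summable_mul_left_iff hc).mp h'.summable
  refine ⟨hsum, ?_⟩
  rw [completedL, ← h'.tsum_eq, tsum_mul_left, LSeries]
  ring

/-- `Ξ(f, z) = Λ(f, k/2 - i z)`. -/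
noncomputable def Xi {N : ℕ} [NeZero N] {k : ℤ} (hk : 0 < k) (f : CuspFormGamma0 N k)
    (z : ℂ) : ℂ :=
  completedL hk f ((k : ℂ) / 2 - I * z)

/-- The right-hand side of `n = ½ (2π e^{(L - log N)/2} - k/2 + 1) L`. -/
noncomputable def saddleFun (N : ℕ) (k : ℤ) (x : ℝ) : ℝ :=
  1 / 2 * (2 * π * Real.exp ((x - Real.log N) / 2) - (k : ℝ) / 2 + 1) * x

/-- The leading term of the expansion, as a function of `n`, of `x = L(n)` and of the eigenvalue
`ε` of the Atkin–Lehner involution. -/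
noncomputable def leadingTerm (N : ℕ) (k : ℤ) (ε : ℂ) (n : ℕ) (x : ℝ) : ℂ :=
  ((√(2 * π) * (N : ℝ) ^ ((k : ℝ) / 4) / 2 ^ (n + 1)
      * (x ^ (n + 1) / √((1 + x / 2) * n + ((k : ℝ) / 2 - 1) * x ^ 2 / 4))
      * Real.exp ((k : ℝ) / 4 * (x - Real.log N) - 2 * n / x - (k : ℝ) / 2 + 1) : ℝ) : ℂ)
    * (1 + (-1) ^ n * I ^ k * ε)

/-- `F(n) ∼ M(n) (1 + c₁(n)/n + c₂(n)/n² + ⋯)` to all orders as `n → ∞`: the truncation after `J`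
correction terms has relative error `O(n^{-(J+1)+δ})` for every `δ > 0`. -/
def HasAllOrdersExpansion (F M : ℕ → ℂ) (c : ℕ → ℕ → ℝ) : Prop :=
  ∀ (J : ℕ) (δ : ℝ), 0 < δ →
    (fun n : ℕ => F n - M n * ((1 + ∑ j ∈ Finset.Icc 1 J, c j n / (n : ℝ) ^ j : ℝ) : ℂ))
      =O[atTop] fun n : ℕ => ‖M n‖ * (n : ℝ) ^ (-((J : ℝ) + 1) + δ)

end ModularAsymptotics

open ModularAsymptotics

/-! Put $\varphi(t)=f(it/\sqrt N)$, $\kappa=k/2-1$ and $c=2\pi/\sqrt N$. Then $\Lambda(f,\cdot)$ is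
the Mellin transform of $\varphi$ (`completedL_eq_mellin`), and the Atkin–Lehner relation reads
$\varphi(1/t)=\epsilon_f i^k t^k\varphi(t)$ (`axis_inv`). Together with the Fourier expansion this
gives rapid decay at both ends, so the Mellin integral may be differentiated under the integral
sign. Folding it at $t=1$ (`mellin_log_fold`) yields $\Lambda^{(n)}(f,k/2)=(1+(-1)^n
i^k\epsilon_f)\int_1^\infty(\log t)^n t^\kappa\varphi(t)\,dt$, where
$\varphi(t)=e^{-ct}(1+O(e^{-ct}))$ because $a(0)=0$ and $a(1)=1$.

The rest is Laplace's method. The integrand $(\log y)^n y^\kappa e^{-cy}$ peaks where $n/\log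
y+\kappa=cy$; for $y=e^{L/2}$ this is the equation defining $L(n)$. With $p=2/L$, $q=p+p^2$,
$s=n^{-1/2}$ and $y=e^{L/2}(1+sz)$, the integrand divided by its peak value is $e^{-qz^2/2}$ times
the exponential of a function analytic in $s$ near $0$. The leading term contains the exact second
derivative $nq+\kappa$ instead of $nq$; the compensating factor $\sqrt{1+\kappa s^2/q}$ is put into
the same exponential (`phase`). The Taylor coefficients in $s$ are polynomials in $z$ with
coefficients rational in $L$. Gaussian integration makes them $\sqrt{2\pi/q}$ times rational
functions of $L$; odd orders vanish by parity, and order $2j$ gives $b_j(L)n^{-j}$.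

The delicate point is uniformity, since $p\to0$ as $n\to\infty$. Cauchy estimates on a disc of
radius comparable to $p/(1+|z|)^3$ control the Taylor remainder, and crude bounds suffice when $s$
is not small against this radius (`kern_sub_taylor_le`). The loss is a power of $1/p=L/2$
(`norm_integral_kern_sub_le`). The remaining Fourier terms contribute a factor $e^{-np/2}$
(`norm_integral_kern_mul_le`). Finally $e^{L/2}\le n\sqrt N$ for large $n$, so every power of $L$ is
$O(n^\delta)$. -/

namespace ModularAsymptotics

open scoped Topology

/-! ### Functions given by rational functions without poles on the positive half-line -/

/-- Functions on `(0, ∞)` given by a rational function over `ℚ` without poles there. -/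
def ratFun : Subring ({x : ℝ // 0 < x} → ℝ) where
  -- `RatFunc.eval` respects sums and products only where the denominators do not vanish, so the
  -- absence of poles is part of membership.
  carrier := {g | ∃ r : RatFunc ℚ, ∀ x : {x : ℝ // 0 < x},
    r.denom.eval₂ (algebraMap ℚ ℝ) x ≠ 0 ∧ r.eval (algebraMap ℚ ℝ) x = g x}
  mul_mem' := by
    rintro a b ⟨r, hr⟩ ⟨t, ht⟩
    refine ⟨r * t, fun x => ⟨fun h => ?_, ?_⟩⟩
    · have := Polynomial.eval₂_eq_zero_of_dvd_of_eval₂_eq_zero (algebraMap ℚ ℝ) (x : ℝ)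
        (RatFunc.denom_mul_dvd r t) h
      rw [Polynomial.eval₂_mul] at this
      exact mul_ne_zero (hr x).1 (ht x).1 this
    · rw [RatFunc.eval_mul _ _ (hr x).1 (ht x).1, (hr x).2, (ht x).2, Pi.mul_apply]
  add_mem' := by
    rintro a b ⟨r, hr⟩ ⟨t, ht⟩
    refine ⟨r + t, fun x => ⟨fun h => ?_, ?_⟩⟩
    · have := Polynomial.eval₂_eq_zero_of_dvd_of_eval₂_eq_zero (algebraMap ℚ ℝ) (x : ℝ)
        (RatFunc.denom_add_dvd r t) h
      rw [Polynomial.eval₂_mul] at this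
      exact mul_ne_zero (hr x).1 (ht x).1 this
    · rw [RatFunc.eval_add _ _ (hr x).1 (ht x).1, (hr x).2, (ht x).2, Pi.add_apply]
  one_mem' := ⟨1, fun x => by simp⟩
  zero_mem' := ⟨0, fun x => by simp⟩
  neg_mem' := by
    rintro a ⟨r, hr⟩
    refine ⟨RatFunc.C (-1) * r, fun x => ⟨fun h => ?_, ?_⟩⟩
    · have := Polynomial.eval₂_eq_zero_of_dvd_of_eval₂_eq_zero (algebraMap ℚ ℝ) (x : ℝ)
        (RatFunc.denom_mul_dvd (RatFunc.C (-1)) r) h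
      rw [RatFunc.denom_C, one_mul] at this
      exact (hr x).1 this
    · rw [RatFunc.eval_mul _ _ (by rw [RatFunc.denom_C]; simp) (hr x).1, (hr x).2, RatFunc.eval_C]
      simp

/-- The reduced denominator divides `Q`, hence has no zero where `Q` has none. -/
theorem ratFunc_eval_div (P Q : Polynomial ℚ) {x : ℝ} (hQ : Q.eval₂ (algebraMap ℚ ℝ) x ≠ 0) :
    (algebraMap _ (RatFunc ℚ) P / algebraMap _ _ Q).denom.eval₂ (algebraMap ℚ ℝ) x ≠ 0 ∧
    (algebraMap _ (RatFunc ℚ) P / algebraMap _ _ Q).eval (algebraMap ℚ ℝ) x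
      = P.eval₂ (algebraMap ℚ ℝ) x / Q.eval₂ (algebraMap ℚ ℝ) x := by
  have hd : (algebraMap _ (RatFunc ℚ) P / algebraMap _ _ Q).denom.eval₂ (algebraMap ℚ ℝ) x ≠ 0 :=
    fun h => hQ (Polynomial.eval₂_eq_zero_of_dvd_of_eval₂_eq_zero (algebraMap ℚ ℝ) x
      (RatFunc.denom_div_dvd P Q) h)
  refine ⟨hd, ?_⟩
  have hQ0 : algebraMap _ (RatFunc ℚ) Q ≠ 0 := by
    intro h
    rw [map_eq_zero_iff _ (RatFunc.algebraMap_injective ℚ)] at h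
    exact hQ (by simp [h])
  have h := RatFunc.eval_mul (algebraMap ℚ ℝ) x hd
    (show ((algebraMap _ (RatFunc ℚ) Q).denom.eval₂ (algebraMap ℚ ℝ) x) ≠ 0 by
      rw [RatFunc.denom_algebraMap]; simp)
  rw [div_mul_cancel₀ _ hQ0, RatFunc.eval_algebraMap, RatFunc.eval_algebraMap] at h
  rw [eq_div_iff hQ]
  exact h.symm

theorem ratFun_div_mem (P Q : Polynomial ℚ)
    (hQ : ∀ x : ℝ, 0 < x → Q.eval₂ (algebraMap ℚ ℝ) x ≠ 0) {g : {x : ℝ // 0 < x} → ℝ}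
    (hg : ∀ x : {x : ℝ // 0 < x},
      g x = P.eval₂ (algebraMap ℚ ℝ) x / Q.eval₂ (algebraMap ℚ ℝ) x) : g ∈ ratFun :=
  ⟨algebraMap _ _ P / algebraMap _ _ Q, fun x => by
    rw [hg]
    exact ratFunc_eval_div P Q (hQ x x.2)⟩

theorem ratFun_const_mem (c : ℚ) : (fun _ => (c : ℝ)) ∈ ratFun :=
  ratFun_div_mem (Polynomial.C c) 1 (by simp) (by simp)

/-- The function `p = 2 / L`. -/
noncomputable def invHalf (x : {x : ℝ // 0 < x}) : ℝ := 2 / x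

/-- The function `1 / (p + p²)` for `p = 2 / L`. -/
noncomputable def invQuad (x : {x : ℝ // 0 < x}) : ℝ := 1 / (invHalf x + invHalf x ^ 2)

theorem invHalf_pos (x : {x : ℝ // 0 < x}) : 0 < invHalf x := div_pos two_pos x.2

theorem invHalf_mem : invHalf ∈ ratFun :=
  ratFun_div_mem (Polynomial.C 2) Polynomial.X (by simp; grind) (by simp [invHalf])

theorem invQuad_mem : invQuad ∈ ratFun := by
  refine ratFun_div_mem (Polynomial.X ^ 2) (2 * (Polynomial.X + 2)) ?_ ?_
  · intro x hx
    simp [Polynomial.eval₂_mul, Polynomial.eval₂_ofNat]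
    positivity
  · intro x
    have := x.2
    simp only [invQuad, invHalf, Polynomial.eval₂_mul, Polynomial.eval₂_ofNat,
      Polynomial.eval₂_pow, Polynomial.eval₂_X, Polynomial.eval₂_add]
    field_simp

/-- Polynomials in `z` with coefficients in `ratFun`, as functions of `L` and `z`. -/
noncomputable def polyEval :
    Polynomial ratFun →+* ({x : ℝ // 0 < x} → ℝ → ℂ) :=
  RingHom.pi fun x => RingHom.pi fun z =>
    ofRealHom.comp (Polynomial.eval₂RingHom
      ((Pi.evalRingHom (fun _ : {x : ℝ // 0 < x} => ℝ) x).comp ratFun.subtype) z)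

theorem polyEval_apply (U : Polynomial ratFun) (x : {x : ℝ // 0 < x}) (z : ℝ) :
    polyEval U x z = ((U.eval₂ ((Pi.evalRingHom (fun _ : {x : ℝ // 0 < x} => ℝ) x).comp
      ratFun.subtype) z : ℝ) : ℂ) := rfl

/-- The ring of functions of `L` and `z` that are polynomial in `z` with coefficients in
`ratFun`. -/
noncomputable def polyFun : Subring ({x : ℝ // 0 < x} → ℝ → ℂ) := polyEval.range

theorem polyFun_of_ratFun {g : {x : ℝ // 0 < x} → ℝ} (hg : g ∈ ratFun) :
    (fun x _ => (g x : ℂ)) ∈ polyFun :=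
  ⟨Polynomial.C ⟨g, hg⟩, by ext; simp [polyEval_apply]⟩

theorem polyFun_var : (fun (_ : {x : ℝ // 0 < x}) (z : ℝ) => (z : ℂ)) ∈ polyFun :=
  ⟨Polynomial.X, by ext; simp [polyEval_apply]⟩

/-! ### Gaussian moments -/

theorem integrable_pow_mul_gaussian {b : ℝ} (hb : 0 < b) (m : ℕ) :
    Integrable fun z : ℝ => z ^ m * Real.exp (-b * z ^ 2) := by
  have h := integrable_rpow_mul_exp_neg_mul_sq hb (s := m) (by
    have : (0 : ℝ) ≤ m := by positivity
    linarith)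
  simpa using h

/-- Integration by parts: $-qz\,e^{-qz^2/2}$ is the derivative of $e^{-qz^2/2}$. -/
theorem gaussian_moment_succ {q : ℝ} (hq : 0 < q) (m : ℕ) :
    ∫ z : ℝ, z ^ (m + 2) * Real.exp (-(q / 2) * z ^ 2)
      = (m + 1) / q * ∫ z : ℝ, z ^ m * Real.exp (-(q / 2) * z ^ 2) := by
  have hb : 0 < q / 2 := by positivity
  have h := integral_mul_deriv_eq_deriv_mul_of_integrable (u := fun z : ℝ => z ^ (m + 1))
    (u' := fun z : ℝ => (m + 1) * z ^ m) (v := fun z : ℝ => Real.exp (-(q / 2) * z ^ 2))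
    (v' := fun z : ℝ => Real.exp (-(q / 2) * z ^ 2) * (-q * z))
    (fun z _ => by simpa using hasDerivAt_pow (m + 1) z)
    (fun z _ => by
      have := ((hasDerivAt_pow 2 z).const_mul (-(q / 2))).exp
      refine this.congr_deriv ?_
      simp only [Nat.cast_ofNat, Nat.reduceSub, pow_one]
      ring)
    (((integrable_pow_mul_gaussian hb (m + 2)).const_mul (-q)).congr (.of_forall fun z => by
      change _ = z ^ (m + 1) * (Real.exp (-(q / 2) * z ^ 2) * (-q * z)); ring))
    (((integrable_pow_mul_gaussian hb m).const_mul (m + 1)).congr (.of_forall fun z => by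
      change _ = (m + 1) * z ^ m * Real.exp (-(q / 2) * z ^ 2); ring))
    (integrable_pow_mul_gaussian hb (m + 1))
  have e1 : (fun z : ℝ => z ^ (m + 1) * (Real.exp (-(q / 2) * z ^ 2) * (-q * z)))
      = fun z => (-q) * (z ^ (m + 2) * Real.exp (-(q / 2) * z ^ 2)) := by
    funext z; ring
  have e2 : (fun z : ℝ => ((m : ℝ) + 1) * z ^ m * Real.exp (-(q / 2) * z ^ 2))
      = fun z => ((m : ℝ) + 1) * (z ^ m * Real.exp (-(q / 2) * z ^ 2)) := by
    funext z; ring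
  rw [e1, e2, integral_const_mul, integral_const_mul] at h
  rw [div_mul_eq_mul_div, eq_div_iff hq.ne']
  linarith

theorem gaussian_moment_zero {q : ℝ} (hq : 0 < q) :
    ∫ z : ℝ, z ^ 0 * Real.exp (-(q / 2) * z ^ 2) = √(2 * π / q) := by
  simp_rw [pow_zero, one_mul]
  rw [integral_gaussian]
  congr 1
  field_simp

theorem gaussian_moment_one {q : ℝ} :
    ∫ z : ℝ, z ^ 1 * Real.exp (-(q / 2) * z ^ 2) = 0 := by
  have h := integral_neg_eq_self (fun z : ℝ => z ^ 1 * Real.exp (-(q / 2) * z ^ 2)) volume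
  simp only [pow_one, even_two, Even.neg_pow, neg_mul, integral_neg] at h ⊢
  linarith

/-- The moment recursion multiplies by $(m+1)/q$, and $1/q$ is `invQuad`, rational in $L$. The
square root enters only through the zeroth moment. -/
theorem gaussian_moment_ratFun (m : ℕ) : ∃ g ∈ ratFun, ∀ x : {x : ℝ // 0 < x},
    ∫ z : ℝ, z ^ m * Real.exp (-((1 / invQuad x) / 2) * z ^ 2)
      = √(2 * π / (1 / invQuad x)) * g x := by
  have hq : ∀ x, 0 < 1 / invQuad x := fun x => by
    have := invHalf_pos x
    unfold invQuad
    positivity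
  induction m using Nat.twoStepInduction with
  | zero => exact ⟨1, one_mem _, fun x => by rw [gaussian_moment_zero (hq x)]; simp⟩
  | one => exact ⟨0, zero_mem _, fun x => by rw [gaussian_moment_one]; simp⟩
  | more m ih _ =>
    obtain ⟨g, hg, h⟩ := ih
    refine ⟨(fun _ => (((m + 1 : ℕ) : ℚ) : ℝ)) * invQuad * g,
      mul_mem (mul_mem (ratFun_const_mem _) invQuad_mem) hg, fun x => ?_⟩
    rw [gaussian_moment_succ (hq x), h]
    simp
    ring

theorem polyFun_gaussian {u : {x : ℝ // 0 < x} → ℝ → ℂ} (hu : u ∈ polyFun) :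
    (∀ x, Integrable fun z : ℝ => u x z * Real.exp (-((1 / invQuad x) / 2) * z ^ 2)) ∧
    ∃ g ∈ ratFun, ∀ x : {x : ℝ // 0 < x},
      ∫ z : ℝ, u x z * Real.exp (-((1 / invQuad x) / 2) * z ^ 2)
        = √(2 * π / (1 / invQuad x)) * g x := by
  obtain ⟨U, rfl⟩ := hu
  have hq : ∀ x, 0 < 1 / invQuad x / 2 := fun x => by
    have := invHalf_pos x
    unfold invQuad
    positivity
  induction U using Polynomial.induction_on' with
  | add U V hU hV =>
    obtain ⟨iU, g, hg, h⟩ := hU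
    obtain ⟨iV, g', hg', h'⟩ := hV
    simp only [map_add, Pi.add_apply, add_mul]
    refine ⟨fun x => (iU x).add (iV x), g + g', add_mem hg hg', fun x => ?_⟩
    rw [integral_add (iU x) (iV x), h, h']
    simp
    ring
  | monomial m a =>
    obtain ⟨g, hg, h⟩ := gaussian_moment_ratFun m
    have e : ∀ x (z : ℝ), polyEval (Polynomial.monomial m a) x z
        * Real.exp (-((1 / invQuad x) / 2) * z ^ 2)
        = (((a : {x : ℝ // 0 < x} → ℝ) x
          * (z ^ m * Real.exp (-((1 / invQuad x) / 2) * z ^ 2)) : ℝ) : ℂ) := by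
      intro x z
      simp [polyEval_apply, mul_assoc]
    simp only [e]
    refine ⟨fun x => ((integrable_pow_mul_gaussian (hq x) m).const_mul _).ofReal,
      a * g, mul_mem a.2 hg, fun x => ?_⟩
    rw [integral_complex_ofReal, integral_const_mul, h]
    simp
    ring

/-! ### Analytic families whose Taylor coefficients are polynomial functions -/

/-- The functions `A L z` are analytic at `0` and their Taylor coefficients up to order `n` are
polynomials in `z` with coefficients in `ratFun`. -/
def HasPolyTaylor (n : ℕ) (A : {x : ℝ // 0 < x} → ℝ → ℂ → ℂ) : Prop :=
  (∀ x z, AnalyticAt ℂ (A x z) 0) ∧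
    ∀ j ≤ n, (fun x z => iteratedDeriv j (A x z) 0) ∈ polyFun

namespace HasPolyTaylor

variable {n : ℕ} {A B : {x : ℝ // 0 < x} → ℝ → ℂ → ℂ}

theorem const {g : {x : ℝ // 0 < x} → ℝ → ℂ} (hg : g ∈ polyFun) :
    HasPolyTaylor n fun x z _ => g x z := by
  refine ⟨fun x z => analyticAt_const, fun j _ => ?_⟩
  simp only [iteratedDeriv_const]
  split_ifs
  · exact hg
  · exact zero_mem _

theorem add (hA : HasPolyTaylor n A) (hB : HasPolyTaylor n B) :
    HasPolyTaylor n fun x z s => A x z s + B x z s := by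
  refine ⟨fun x z => (hA.1 x z).fun_add (hB.1 x z), fun j hj => ?_⟩
  have := add_mem (hA.2 j hj) (hB.2 j hj)
  convert this using 1
  funext x z
  exact iteratedDeriv_fun_add (hA.1 x z).contDiffAt (hB.1 x z).contDiffAt

theorem mul (hA : HasPolyTaylor n A) (hB : HasPolyTaylor n B) :
    HasPolyTaylor n fun x z s => A x z s * B x z s := by
  refine ⟨fun x z => (hA.1 x z).fun_mul (hB.1 x z), fun j hj => ?_⟩
  have : (∑ i ∈ Finset.range (j + 1), (fun x z => ((j.choose i : ℕ) : ℂ)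
      * iteratedDeriv i (A x z) 0 * iteratedDeriv (j - i) (B x z) 0)) ∈ polyFun := by
    refine sum_mem fun i hi => ?_
    rw [Finset.mem_range] at hi
    exact mul_mem (mul_mem (natCast_mem polyFun (j.choose i)) (hA.2 i (by lia)))
      (hB.2 (j - i) (by lia))
  convert this using 1
  funext x z
  rw [iteratedDeriv_fun_mul (hA.1 x z).contDiffAt (hB.1 x z).contDiffAt]
  simp [Finset.sum_apply]

theorem const_mul {g : {x : ℝ // 0 < x} → ℝ → ℂ} (hg : g ∈ polyFun) (hA : HasPolyTaylor n A) :
    HasPolyTaylor n fun x z s => g x z * A x z s :=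
  (const hg).mul hA

/-- Order $j+1$ for $A$ is order $j$ for $A'$, so only orders below $n$ are required of $B$.
Families closed under differentiation can therefore be treated by strong induction on $n$. -/
theorem of_deriv (hA : ∀ x z, AnalyticAt ℂ (A x z) 0) (h0 : (fun x z => A x z 0) ∈ polyFun)
    (hd : ∀ x z, deriv (A x z) =ᶠ[𝓝 0] B x z) (hB : ∀ m < n, HasPolyTaylor m B) :
    HasPolyTaylor n A := by
  refine ⟨hA, fun j hj => ?_⟩
  cases j with
  | zero => simpa using h0
  | succ j =>
    convert (hB j (by lia)).2 j le_rfl using 1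
    funext x z
    rw [iteratedDeriv_succ']
    exact (hd x z).iteratedDeriv_eq j

theorem deriv (hA : HasPolyTaylor (n + 1) A) : HasPolyTaylor n fun x z => deriv (A x z) :=
  ⟨fun x z => (hA.1 x z).deriv, fun j hj => by
    simpa only [iteratedDeriv_succ'] using hA.2 (j + 1) (by lia)⟩

theorem of_le {m : ℕ} (hA : HasPolyTaylor n A) (h : m ≤ n) : HasPolyTaylor m A :=
  ⟨hA.1, fun j hj => hA.2 j (hj.trans h)⟩

theorem id : HasPolyTaylor n fun _ _ s => s := by
  refine of_deriv (fun _ _ => analyticAt_id) (zero_mem _) (B := fun _ _ _ => 1)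
    (fun x z => .of_forall fun s => by simp) fun m _ => const (one_mem _)

/-- Induction through $(e^A)'=A'e^A$. The condition $A(0)=0$ makes the constant term $1$ rather than
a transcendental function of $L$ and $z$. -/
theorem exp (hA : HasPolyTaylor n A) (h0 : ∀ x z, A x z 0 = 0) :
    HasPolyTaylor n fun x z s => cexp (A x z s) := by
  induction n with
  | zero =>
    refine ⟨fun x z => (hA.1 x z).cexp', fun j hj => ?_⟩
    obtain rfl : j = 0 := by lia
    simp only [iteratedDeriv_zero, h0, Complex.exp_zero]
    exact one_mem _
  | succ n ih =>
    refine of_deriv (B := fun x z s => _root_.deriv (A x z) s * cexp (A x z s))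
      (fun x z => (hA.1 x z).cexp') ?_ ?_ fun m hm => ?_
    · simp only [h0, Complex.exp_zero]
      exact one_mem _
    · intro x z
      filter_upwards [(hA.1 x z).eventually_analyticAt] with s hs
      rw [deriv_cexp hs.differentiableAt, mul_comm]
    · exact (hA.deriv.mul (ih (hA.of_le (Nat.le_succ n)))).of_le (Nat.lt_succ_iff.mp hm)

end HasPolyTaylor

theorem iteratedDeriv_comp_mul_left' (g : ℂ → ℂ) (c : ℂ) (j : ℕ) :
    iteratedDeriv j (fun s => g (c * s)) = fun s => c ^ j * iteratedDeriv j g (c * s) := by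
  induction j generalizing g with
  | zero => simp
  | succ j ih =>
    rw [iteratedDeriv_succ, ih, iteratedDeriv_succ]
    funext s
    rw [deriv_const_mul_field, deriv_comp_mul_left, smul_eq_mul]
    ring

/-- The chain rule contributes $z^j$ to the coefficient of order $j$, which keeps it polynomial in
$z$. -/
theorem HasPolyTaylor.scale {n : ℕ} {A : {x : ℝ // 0 < x} → ℝ → ℂ → ℂ} (hA : HasPolyTaylor n A) :
    HasPolyTaylor n fun x z s => A x z (z * s) := by
  refine ⟨fun x z => ?_, fun j hj => ?_⟩
  · refine AnalyticAt.fun_comp (g := A x z) (f := fun s : ℂ => (z : ℂ) * s) ?_ (by fun_prop)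
    simpa using hA.1 x z
  · have := mul_mem (pow_mem polyFun_var j) (hA.2 j hj)
    convert this using 1
    funext x z
    simp [iteratedDeriv_comp_mul_left']

/-- Dividing $g(s)-g(0)$ by $s$ shifts the power series by one place; the quotient of factorials is
$j+1$. -/
theorem iteratedDeriv_dslope {g : ℂ → ℂ} (hg : AnalyticAt ℂ g 0) (j : ℕ) :
    iteratedDeriv j (dslope g 0) 0 = iteratedDeriv (j + 1) g 0 / (j + 1) := by
  have h1 := hg.hasFPowerSeriesAt.has_fpower_series_dslope_fslope
  have h2 := h1.analyticAt.hasFPowerSeriesAt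
  have h3 := congrArg (fun p => p.coeff j) (h2.eq_formalMultilinearSeries h1)
  simp only [FormalMultilinearSeries.coeff_ofScalars, FormalMultilinearSeries.coeff_fslope,
    Nat.factorial_succ] at h3
  have hj : (j.factorial : ℂ) ≠ 0 := by exact_mod_cast j.factorial_ne_zero
  have hj1 : (j + 1 : ℂ) ≠ 0 := by exact_mod_cast j.succ_ne_zero
  push_cast at h3
  field_simp at h3 ⊢
  linear_combination h3

theorem analyticAt_dslope {g : ℂ → ℂ} (hg : AnalyticAt ℂ g 0) : AnalyticAt ℂ (dslope g 0) 0 :=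
  hg.hasFPowerSeriesAt.has_fpower_series_dslope_fslope.analyticAt

theorem HasPolyTaylor.dslope {n : ℕ} {A : {x : ℝ // 0 < x} → ℝ → ℂ → ℂ}
    (hA : HasPolyTaylor (n + 1) A) : HasPolyTaylor n fun x z => dslope (A x z) 0 := by
  refine ⟨fun x z => analyticAt_dslope (hA.1 x z), fun j hj => ?_⟩
  have h := mul_mem (polyFun_of_ratFun (ratFun_const_mem (1 / (j + 1)))) (hA.2 (j + 1) (by lia))
  convert h using 1
  funext x z
  rw [iteratedDeriv_dslope (hA.1 x z)]
  simp
  ring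

/-! ### The iterated logarithm -/

/-- The function `v ↦ log (1 + p log (1 + v))`. -/
noncomputable def logLog (p : ℝ) (v : ℂ) : ℂ := Complex.log (1 + p * Complex.log (1 + v))

/-- The functions `v ↦ (1 + v)^{-a} (1 + p log (1 + v))^{-b}`, whose span is stable under
differentiation. -/
noncomputable def invPow (a b : ℕ) (p : ℝ) (v : ℂ) : ℂ :=
  ((1 + v) ^ a)⁻¹ * ((1 + p * Complex.log (1 + v)) ^ b)⁻¹

theorem norm_log_one_add_le_half {v : ℂ} (hv : ‖v‖ < 1 / 4) : ‖Complex.log (1 + v)‖ ≤ 1 / 2 := by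
  have h := Complex.norm_log_one_add_half_le_self (z := v) (by linarith)
  linarith

theorem one_add_mem_slitPlane {w : ℂ} (hw : ‖w‖ < 1) : 1 + w ∈ Complex.slitPlane :=
  Complex.mem_slitPlane_of_norm_lt_one hw

theorem norm_mul_log_le {p : ℝ} (hp : |p| ≤ 1) {v : ℂ} (hv : ‖v‖ < 1 / 4) :
    ‖(p : ℂ) * Complex.log (1 + v)‖ ≤ 1 / 2 := by
  rw [norm_mul, Complex.norm_real, Real.norm_eq_abs]
  have := norm_log_one_add_le_half hv
  nlinarith [norm_nonneg (Complex.log (1 + v)), abs_nonneg p]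

theorem analyticAt_logLog_zero (p : ℝ) : AnalyticAt ℂ (logLog p) 0 := by
  have h : AnalyticAt ℂ (fun v : ℂ => Complex.log (1 + v)) 0 :=
    AnalyticAt.clog (by fun_prop) (by simp)
  exact AnalyticAt.clog (by fun_prop) (by simp)

theorem analyticAt_invPow (a b : ℕ) (p : ℝ) : AnalyticAt ℂ (invPow a b p) 0 := by
  have h : AnalyticAt ℂ (fun v : ℂ => Complex.log (1 + v)) 0 :=
    AnalyticAt.clog (by fun_prop) (by simp)
  exact AnalyticAt.fun_mul (AnalyticAt.fun_inv (by fun_prop) (by simp))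
    (AnalyticAt.fun_inv (by fun_prop) (by simp))

theorem eventually_slitPlane (p : ℝ) : ∀ᶠ v : ℂ in 𝓝 0, 1 + v ∈ Complex.slitPlane ∧
    1 + p * Complex.log (1 + v) ∈ Complex.slitPlane := by
  have c1 : ContinuousAt (fun v : ℂ => 1 + v) 0 := by fun_prop
  have c2 : ContinuousAt (fun v : ℂ => 1 + p * Complex.log (1 + v)) 0 := by
    have := c1.clog (by simp)
    fun_prop
  exact (c1.eventually_mem (Complex.isOpen_slitPlane.mem_nhds (by simp))).and
    (c2.eventually_mem (Complex.isOpen_slitPlane.mem_nhds (by simp)))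

theorem hasDerivAt_one_add_log (p : ℝ) {v : ℂ} (h1 : 1 + v ∈ Complex.slitPlane) :
    HasDerivAt (fun v : ℂ => 1 + p * Complex.log (1 + v)) (p * (1 + v)⁻¹) v := by
  have := ((((hasDerivAt_id v).const_add 1).clog h1).const_mul (p : ℂ)).const_add 1
  simpa [one_div] using this

theorem deriv_logLog (p : ℝ) : deriv (logLog p) =ᶠ[𝓝 0] fun v => p * invPow 1 1 p v := by
  filter_upwards [eventually_slitPlane p] with v hv
  have := ((hasDerivAt_one_add_log p hv.1).clog hv.2).deriv
  rw [show logLog p = fun v => Complex.log (1 + p * Complex.log (1 + v)) from rfl, this, invPow]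
  simp only [pow_one]
  ring

theorem deriv_invPow (a b : ℕ) (p : ℝ) : deriv (invPow a b p) =ᶠ[𝓝 0]
    fun v => -a * invPow (a + 1) b p v + -(b * p) * invPow (a + 1) (b + 1) p v := by
  filter_upwards [eventually_slitPlane p] with v hv
  have n1 := Complex.slitPlane_ne_zero hv.1
  have n2 := Complex.slitPlane_ne_zero hv.2
  have h1 : HasDerivAt (fun v : ℂ => ((1 + v) ^ a)⁻¹) (-a * ((1 + v) ^ (a + 1))⁻¹) v := by
    have := (((hasDerivAt_id v).const_add 1).fun_pow a).fun_inv (pow_ne_zero a n1)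
    refine this.congr_deriv ?_
    cases a with
    | zero => simp
    | succ a => simp only [id, Nat.add_sub_cancel]; field_simp; ring
  have h2 : HasDerivAt (fun v : ℂ => ((1 + p * Complex.log (1 + v)) ^ b)⁻¹)
      (-b * ((1 + p * Complex.log (1 + v)) ^ (b + 1))⁻¹ * (p * (1 + v)⁻¹)) v := by
    have := ((hasDerivAt_one_add_log p hv.1).fun_pow b).fun_inv (pow_ne_zero b n2)
    refine this.congr_deriv ?_
    cases b with
    | zero => simp
    | succ b => simp only [Nat.add_sub_cancel]; field_simp; ring
  rw [show invPow a b p = fun v => ((1 + v) ^ a)⁻¹ * ((1 + p * Complex.log (1 + v)) ^ b)⁻¹ from rfl,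
    (h1.fun_mul h2).deriv]
  simp only [invPow]
  field_simp
  ring

/-- Differentiation stays in the span of these functions, with coefficients $-a$ and $-bp$, and each
of them equals $1$ at $0$. -/
theorem hasPolyTaylor_invPow (n a b : ℕ) :
    HasPolyTaylor n fun x _ => invPow a b (invHalf x) := by
  induction n using Nat.strong_induction_on generalizing a b with
  | _ n ih =>
    refine HasPolyTaylor.of_deriv (fun x z => analyticAt_invPow a b _) ?_
      (fun x z => deriv_invPow a b _) fun m hm => ?_
    · simp only [invPow, add_zero, Complex.log_one, mul_zero, one_pow, inv_one, mul_one]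
      exact one_mem _
    · exact (HasPolyTaylor.const_mul (neg_mem (natCast_mem polyFun a)) (ih m hm _ _)).add
        (HasPolyTaylor.const_mul (neg_mem (mul_mem (natCast_mem polyFun b)
          (polyFun_of_ratFun invHalf_mem))) (ih m hm _ _))

theorem hasPolyTaylor_logLog (n : ℕ) : HasPolyTaylor n fun x _ => logLog (invHalf x) := by
  refine HasPolyTaylor.of_deriv (fun x z => analyticAt_logLog_zero _) ?_
    (fun x z => deriv_logLog _) fun m hm =>
      HasPolyTaylor.const_mul (polyFun_of_ratFun invHalf_mem) (hasPolyTaylor_invPow m 1 1)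
  simp only [logLog, add_zero, Complex.log_one, mul_zero]
  exact zero_mem _

theorem hasPolyTaylor_log (n : ℕ) : HasPolyTaylor n fun _ _ v => Complex.log (1 + v) := by
  refine HasPolyTaylor.of_deriv (fun x z => AnalyticAt.clog (by fun_prop) (by simp)) ?_
    (B := fun x _ => invPow 1 0 (invHalf x)) (fun x z => ?_)
    fun m hm => hasPolyTaylor_invPow m 1 0
  · simp only [add_zero, Complex.log_one]
    exact zero_mem _
  · filter_upwards [eventually_slitPlane (invHalf x)] with v hv
    have := (((hasDerivAt_id v).const_add 1).clog hv.1).deriv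
    simpa [invPow] using this

theorem hasPolyTaylor_log_sq (n : ℕ) (w : {x : ℝ // 0 < x} → ℝ) (hw : w ∈ ratFun) :
    HasPolyTaylor n fun x _ s => Complex.log (1 + w x * s ^ 2) := by
  have ev : ∀ x, ∀ᶠ s : ℂ in 𝓝 0, 1 + w x * s ^ 2 ∈ Complex.slitPlane := fun x => by
    have c : ContinuousAt (fun s : ℂ => 1 + w x * s ^ 2) 0 := by fun_prop
    exact c.eventually_mem (Complex.isOpen_slitPlane.mem_nhds (by simp))
  have hd : ∀ x (s : ℂ), HasDerivAt (fun s : ℂ => 1 + w x * s ^ 2) (2 * w x * s) s := by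
    intro x s
    refine (((hasDerivAt_pow 2 s).const_mul (w x : ℂ)).const_add 1).congr_deriv ?_
    simp only [Nat.cast_ofNat, Nat.reduceSub, pow_one]
    ring
  have h2w : (fun x _ => (2 * w x : ℂ)) ∈ polyFun :=
    mul_mem (ofNat_mem polyFun 2) (polyFun_of_ratFun hw)
  -- The powers $(1+ws^2)^{-b}$ are closed under differentiation up to the factor $-2bws$, so the
  -- same strong induction applies to all $b$ at once.
  have hinv : ∀ m b, HasPolyTaylor m fun x _ (s : ℂ) => ((1 + w x * s ^ 2) ^ b)⁻¹ := by
    intro m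
    induction m using Nat.strong_induction_on with
    | _ m ih =>
      intro b
      refine HasPolyTaylor.of_deriv
        (fun x z => AnalyticAt.fun_inv (by fun_prop) (by simp)) ?_
        (B := fun x _ s => -b * ((2 * w x) * (s * ((1 + w x * s ^ 2) ^ (b + 1))⁻¹)))
        (fun x z => ?_) fun j hj => ?_
      · simp only [ne_eq, OfNat.ofNat_ne_zero, not_false_eq_true, zero_pow, mul_zero, add_zero,
          one_pow, inv_one]
        exact one_mem _
      · filter_upwards [ev x] with s hs
        have n1 := Complex.slitPlane_ne_zero hs
        rw [(((hd x s).fun_pow b).fun_inv (pow_ne_zero b n1)).deriv]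
        cases b with
        | zero => simp
        | succ b => simp only [Nat.add_sub_cancel]; field_simp; ring
      · exact HasPolyTaylor.const_mul (neg_mem (natCast_mem polyFun b))
          (HasPolyTaylor.const_mul h2w (HasPolyTaylor.id.mul (ih j hj _)))
  refine HasPolyTaylor.of_deriv (fun x z => AnalyticAt.clog (by fun_prop) (by simp)) ?_
    (B := fun x _ s => (2 * w x) * (s * ((1 + w x * s ^ 2) ^ 1)⁻¹)) (fun x z => ?_)
    fun m hm => HasPolyTaylor.const_mul h2w (HasPolyTaylor.id.mul (hinv m 1))
  · simp only [ne_eq, OfNat.ofNat_ne_zero, not_false_eq_true, zero_pow, mul_zero, add_zero,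
      Complex.log_one]
    exact zero_mem _
  · filter_upwards [ev x] with s hs
    rw [((hd x s).clog hs).deriv]
    ring

/-! ### Taylor expansion of bounded analytic functions -/

theorem norm_taylor_coeff_le {F : ℂ → ℂ} {R ρ B : ℝ} (hρ : 0 < ρ) (hR : ρ < R)
    (hF : DifferentiableOn ℂ F (Metric.ball 0 R)) (hB : ∀ s ∈ Metric.ball (0 : ℂ) R, ‖F s‖ ≤ B)
    (i : ℕ) : ‖iteratedDeriv i F 0 / (i.factorial : ℂ)‖ ≤ B / ρ ^ i := by
  have hsub : Metric.closedBall (0 : ℂ) ρ ⊆ Metric.ball 0 R := Metric.closedBall_subset_ball hR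
  have h := Complex.norm_iteratedDeriv_le_of_forall_mem_sphere_norm_le (C := B) i hρ
    ((hF.mono hsub).diffContOnCl_ball (subset_refl _))
    fun z hz => hB z (hsub (Metric.sphere_subset_closedBall hz))
  have hi : (0 : ℝ) < i.factorial := by exact_mod_cast i.factorial_pos
  rw [norm_div, Complex.norm_natCast, div_le_iff₀ hi]
  calc _ ≤ _ := h
    _ = _ := by ring

/-- By Cauchy's estimate the tail is dominated by a geometric series of ratio $\|s\|/\rho\le1/2$,
whose sum costs the factor $2$. -/
theorem norm_taylor_remainder_le {F : ℂ → ℂ} {R ρ B : ℝ} (hρ : 0 < ρ) (hR : ρ < R)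
    (hF : DifferentiableOn ℂ F (Metric.ball 0 R)) (hB : ∀ s ∈ Metric.ball (0 : ℂ) R, ‖F s‖ ≤ B)
    {s : ℂ} (hs : ‖s‖ ≤ ρ / 2) (m : ℕ) :
    ‖F s - ∑ i ∈ Finset.range m, iteratedDeriv i F 0 / (i.factorial : ℂ) * s ^ i‖
      ≤ 2 * B * (‖s‖ / ρ) ^ m := by
  have hsR : s ∈ Metric.ball (0 : ℂ) R := by
    rw [mem_ball_zero_iff]; linarith
  have hB0 : 0 ≤ B := (norm_nonneg _).trans (hB s hsR)
  set t := ‖s‖ / ρ with ht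
  have ht0 : 0 ≤ t := by positivity
  have ht2 : t ≤ 1 / 2 := by rw [ht, div_le_iff₀ hρ]; linarith
  have h := Complex.hasSum_taylorSeries_on_ball hF hsR
  have hterm : ∀ i, ((i.factorial : ℂ))⁻¹ • (s - 0) ^ i • iteratedDeriv i F 0
      = iteratedDeriv i F 0 / (i.factorial : ℂ) * s ^ i := fun i => by
    simp only [smul_eq_mul, sub_zero]; ring
  simp only [hterm] at h
  have h' := (hasSum_nat_add_iff' m).mpr h
  rw [← h'.tsum_eq]
  have hg : HasSum (fun i : ℕ => B * t ^ m * t ^ i) (B * t ^ m * (1 - t)⁻¹) :=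
    (hasSum_geometric_of_lt_one ht0 (by linarith)).mul_left _
  have hle : ∀ i : ℕ, ‖iteratedDeriv (i + m) F 0 / ((i + m).factorial : ℂ) * s ^ (i + m)‖
      ≤ B * t ^ m * t ^ i := fun i => by
    rw [norm_mul, norm_pow, mul_assoc, ← pow_add, add_comm m i, ht, div_pow, ← mul_div_assoc,
      mul_div_right_comm]
    gcongr
    exact norm_taylor_coeff_le hρ hR hF hB _
  refine (tsum_of_norm_bounded hg hle).trans ?_
  have : (1 - t)⁻¹ ≤ 2 := by
    rw [inv_le_comm₀ (by linarith) (by norm_num)]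
    linarith
  have h0 : 0 ≤ B * t ^ m := by positivity
  nlinarith

/-! ### The phase function -/

/-- The second divided difference of `logLog p` at `0`. -/
noncomputable def logLogQuot (p : ℝ) : ℂ → ℂ := dslope (dslope (logLog p) 0) 0

/-- The logarithm of the rescaled integrand divided by its Gaussian part. -/
noncomputable def phase (κ : ℕ) (p z : ℝ) (s : ℂ) : ℂ :=
  z ^ 2 * (logLogQuot p (z * s) + ((p + p ^ 2) / 2 : ℝ))
    + κ * (Complex.log (1 + z * s) - z * s)
    + 1 / 2 * Complex.log (1 + (κ / (p + p ^ 2) : ℝ) * s ^ 2)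

theorem hasDeriv_logLog_zero (p : ℝ) : deriv (logLog p) 0 = p := by
  rw [(deriv_logLog p).eq_of_nhds]
  simp [invPow]

theorem logLog_zero (p : ℝ) : logLog p 0 = 0 := by simp [logLog]

/-- With $v=zs$ and $ns^2=1$ this rewrites $n(\log(1+p\log(1+v))-pv)$ as $z^2$ times the divided
difference at $zs$, so that $n$ disappears from the exponent. -/
theorem sq_mul_logLogQuot (p : ℝ) (v : ℂ) : v ^ 2 * logLogQuot p v = logLog p v - p * v := by
  have h1 := sub_smul_dslope (logLog p) 0 v
  have h2 := sub_smul_dslope (dslope (logLog p) 0) 0 v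
  rw [dslope_same, hasDeriv_logLog_zero] at h2
  simp only [sub_zero, smul_eq_mul, logLog_zero] at h1 h2
  rw [logLogQuot]
  linear_combination v * h2 + h1

theorem iteratedDeriv_logLog_succ (p : ℝ) (r : ℕ) :
    iteratedDeriv (r + 1) (logLog p) 0 = p * iteratedDeriv r (invPow 1 1 p) 0 := by
  rw [iteratedDeriv_succ', (deriv_logLog p).iteratedDeriv_eq,
    iteratedDeriv_const_mul _ (analyticAt_invPow 1 1 p).contDiffAt]

theorem iteratedDeriv_invPow_zero (p : ℝ) (a b : ℕ) : iteratedDeriv 0 (invPow a b p) 0 = 1 := by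
  simp [invPow]

theorem iteratedDeriv_invPow_succ (p : ℝ) (a b r : ℕ) :
    iteratedDeriv (r + 1) (invPow a b p) 0 =
      -a * iteratedDeriv r (invPow (a + 1) b p) 0
        + -(b * p) * iteratedDeriv r (invPow (a + 1) (b + 1) p) 0 := by
  have h1 := fun a b => (analyticAt_invPow a b p).contDiffAt (n := r)
  rw [iteratedDeriv_succ', (deriv_invPow a b p).iteratedDeriv_eq,
    iteratedDeriv_fun_add (contDiffAt_const.mul (h1 _ _)) (contDiffAt_const.mul (h1 _ _)),
    iteratedDeriv_const_mul _ (h1 _ _), iteratedDeriv_const_mul _ (h1 _ _)]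

theorem iteratedDeriv_logLogQuot (p : ℝ) (j : ℕ) :
    iteratedDeriv j (logLogQuot p) 0
      = iteratedDeriv (j + 2) (logLog p) 0 / ((j + 2) * (j + 1)) := by
  have h := analyticAt_logLog_zero p
  rw [logLogQuot, iteratedDeriv_dslope (analyticAt_dslope h), iteratedDeriv_dslope h]
  push_cast
  rw [div_div, add_assoc (j : ℂ), one_add_one_eq_two]

theorem analyticAt_logLogQuot (p : ℝ) : AnalyticAt ℂ (logLogQuot p) 0 :=
  analyticAt_dslope (analyticAt_dslope (analyticAt_logLog_zero p))

theorem logLogQuot_zero (p : ℝ) : logLogQuot p 0 = -((p + p ^ 2) / 2 : ℝ) := by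
  have h := iteratedDeriv_logLogQuot p 0
  rw [iteratedDeriv_zero] at h
  rw [h]
  simp [iteratedDeriv_logLog_succ, iteratedDeriv_invPow_succ, invPow]
  ring

theorem phase_zero (κ : ℕ) (p z : ℝ) : phase κ p z 0 = 0 := by
  simp [phase, logLogQuot_zero]

/-- The phase involves $z$ and $s$ only through $z^2$, $s^2$ and $zs$. This parity is what removes
the half-integral powers of $1/n$. -/
theorem phase_neg (κ : ℕ) (p z : ℝ) (s : ℂ) : phase κ p (-z) (-s) = phase κ p z s := by
  simp [phase]

theorem hasPolyTaylor_phase (κ n : ℕ) :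
    HasPolyTaylor n fun x z => phase κ (invHalf x) z := by
  have h1 : HasPolyTaylor n fun x z s => logLogQuot (invHalf x) (z * s) :=
    ((hasPolyTaylor_logLog (n + 2)).dslope.dslope).scale
  have h2 := (hasPolyTaylor_log n).scale
  have hz : (fun (_ : {x : ℝ // 0 < x}) (z : ℝ) => (z : ℂ)) ∈ polyFun := polyFun_var
  have hq : (fun x => (invHalf x + invHalf x ^ 2) / 2) ∈ ratFun := by
    have := mul_mem (add_mem invHalf_mem (pow_mem invHalf_mem 2)) (ratFun_const_mem (1 / 2))
    convert this using 1
    funext x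
    simp
    ring
  have hw : (fun x => (κ / (invHalf x + invHalf x ^ 2) : ℝ)) ∈ ratFun := by
    have := mul_mem (ratFun_const_mem κ) invQuad_mem
    convert this using 1
    funext x
    simp [invQuad]
    ring
  have h3 := (HasPolyTaylor.const_mul (pow_mem hz 2) (h1.add
    (HasPolyTaylor.const (polyFun_of_ratFun hq)))).add
    ((HasPolyTaylor.const_mul (natCast_mem polyFun κ) (h2.add
      (HasPolyTaylor.const_mul (neg_mem hz) HasPolyTaylor.id)))) |>.add
    (HasPolyTaylor.const_mul (polyFun_of_ratFun (ratFun_const_mem (1 / 2)))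
      (hasPolyTaylor_log_sq n _ hw))
  convert h3 using 1
  funext x z s
  simp only [phase, Pi.pow_apply, Pi.natCast_apply, Pi.neg_apply]
  push_cast
  ring

/-- The Taylor coefficients at `0` of the exponential of `phase`. -/
noncomputable def expCoeff (κ i : ℕ) (p z : ℝ) : ℂ :=
  iteratedDeriv i (fun s => cexp (phase κ p z s)) 0 / (i.factorial : ℂ)

theorem expCoeff_mem (κ i : ℕ) : (fun x z => expCoeff κ i (invHalf x) z) ∈ polyFun := by
  have h := ((hasPolyTaylor_phase κ i).exp fun x z => phase_zero κ _ z).2 i le_rfl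
  have := mul_mem (polyFun_of_ratFun (ratFun_const_mem (1 / (i.factorial : ℚ)))) h
  convert this using 1
  funext x z
  simp [expCoeff]
  ring

theorem expCoeff_neg (κ i : ℕ) (p z : ℝ) :
    expCoeff κ i p (-z) = (-1) ^ i * expCoeff κ i p z := by
  have h := iteratedDeriv_comp_neg i (fun s => cexp (phase κ p (-z) s)) 0
  simp only [phase_neg, neg_zero, smul_eq_mul] at h
  simp only [expCoeff]
  rw [h]
  ring_nf
  simp

theorem expCoeff_zero (κ : ℕ) (p z : ℝ) : expCoeff κ 0 p z = 1 := by
  simp [expCoeff, phase_zero]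

theorem analyticAt_phase (κ : ℕ) (p z : ℝ) : AnalyticAt ℂ (phase κ p z) 0 := by
  have h1 : AnalyticAt ℂ (fun s : ℂ => logLogQuot p (z * s)) 0 :=
    AnalyticAt.fun_comp (g := logLogQuot p) (f := fun s : ℂ => (z : ℂ) * s)
      (by simpa using analyticAt_logLogQuot p) (by fun_prop)
  have h2 : AnalyticAt ℂ (fun s : ℂ => Complex.log (1 + z * s)) 0 :=
    AnalyticAt.clog (by fun_prop) (by simp)
  have h3 : AnalyticAt ℂ (fun s : ℂ => Complex.log (1 + (κ / (p + p ^ 2) : ℝ) * s ^ 2)) 0 :=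
    AnalyticAt.clog (by fun_prop) (by simp)
  unfold phase
  fun_prop

theorem expCoeff_two (κ : ℕ) {p : ℝ} (z : ℝ) :
    expCoeff κ 2 p z = (iteratedDeriv 2 (phase κ p z) 0 + deriv (phase κ p z) 0 ^ 2) / 2 := by
  have ha := analyticAt_phase κ p z
  have e : deriv (fun s => cexp (phase κ p z s)) =ᶠ[𝓝 0]
      fun s => cexp (phase κ p z s) * deriv (phase κ p z) s := by
    filter_upwards [ha.eventually_analyticAt] with s hs
    exact deriv_cexp hs.differentiableAt
  have hd := (ha.differentiableAt.hasDerivAt.cexp.mul ha.deriv.differentiableAt.hasDerivAt).deriv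
  rw [expCoeff, iteratedDeriv_succ', iteratedDeriv_one, e.deriv_eq]
  rw [iteratedDeriv_succ', iteratedDeriv_one]
  have : deriv (fun s => cexp (phase κ p z s) * deriv (phase κ p z) s) 0 = _ := hd
  rw [this, phase_zero]
  simp
  ring

theorem deriv_phase (κ : ℕ) (p z : ℝ) (j : ℕ) (hj : 0 < j) : iteratedDeriv j (phase κ p z) 0 =
    z ^ 2 * (z ^ j * iteratedDeriv j (logLogQuot p) 0)
      + κ * (z ^ j * iteratedDeriv j (fun v => Complex.log (1 + v) - v) 0)
      + 1 / 2 * iteratedDeriv j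
        (fun s => Complex.log (1 + (κ / (p + p ^ 2) : ℝ) * s ^ 2)) 0 := by
  have h1 : AnalyticAt ℂ (fun s : ℂ => logLogQuot p (z * s)) 0 :=
    AnalyticAt.fun_comp (g := logLogQuot p) (f := fun s : ℂ => (z : ℂ) * s)
      (by simpa using analyticAt_logLogQuot p) (by fun_prop)
  have h2 : AnalyticAt ℂ (fun s : ℂ => Complex.log (1 + z * s) - z * s) 0 :=
    AnalyticAt.fun_sub (AnalyticAt.clog (by fun_prop) (by simp)) (by fun_prop)
  have h3 : AnalyticAt ℂ (fun s : ℂ => Complex.log (1 + (κ / (p + p ^ 2) : ℝ) * s ^ 2)) 0 :=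
    AnalyticAt.clog (by fun_prop) (by simp)
  have c1 := h1.contDiffAt (n := j)
  have c2 := h2.contDiffAt (n := j)
  have c3 := h3.contDiffAt (n := j)
  have c4 := contDiffAt_const (𝕜 := ℂ) (n := (j : WithTop ℕ∞)) (x := (0 : ℂ))
    (c := (((p + p ^ 2) / 2 : ℝ) : ℂ))
  unfold phase
  rw [iteratedDeriv_fun_add ((contDiffAt_const.mul (c1.add c4)).add (contDiffAt_const.mul c2))
      (contDiffAt_const.mul c3),
    iteratedDeriv_fun_add (contDiffAt_const.mul (c1.add c4)) (contDiffAt_const.mul c2),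
    iteratedDeriv_const_mul _ (c1.add c4), iteratedDeriv_const_mul _ c2,
    iteratedDeriv_const_mul _ c3, iteratedDeriv_fun_add c1 c4, iteratedDeriv_const,
    if_neg hj.ne', iteratedDeriv_comp_mul_left' (logLogQuot p),
    iteratedDeriv_comp_mul_left' (fun v => Complex.log (1 + v) - v)]
  simp

/-- The $z^6$ term is the square of the cubic term of the exponent and the $z^4$ term is its quartic
term. The last two terms come from $y^\kappa$ and from the factor $\sqrt{1+\kappa s^2/q}$. -/
theorem expCoeff_two_eq (κ : ℕ) (p z : ℝ) :
    expCoeff κ 2 p z = (((p * (2 + 3 * p + 2 * p ^ 2)) ^ 2 / 72 * z ^ 6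
      - p * (6 + 11 * p + 12 * p ^ 2 + 6 * p ^ 3) / 24 * z ^ 4
      - κ / 2 * z ^ 2 + κ / (p + p ^ 2) / 2 : ℝ) : ℂ) := by
  have l1 : HasDerivAt (fun v : ℂ => Complex.log (1 + v) - v) 0 0 := by
    have := (((hasDerivAt_id (0 : ℂ)).const_add 1).clog (by simp)).fun_sub (hasDerivAt_id (0 : ℂ))
    simpa using this
  have l2 : iteratedDeriv 2 (fun v : ℂ => Complex.log (1 + v) - v) 0 = -1 := by
    have e : deriv (fun v : ℂ => Complex.log (1 + v) - v) =ᶠ[𝓝 0] fun v => (1 + v)⁻¹ - 1 := by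
      filter_upwards [eventually_slitPlane 0] with v hv
      have := (((hasDerivAt_id v).const_add 1).clog hv.1).sub (hasDerivAt_id v)
      simpa [Pi.sub_def] using this.deriv
    rw [iteratedDeriv_succ', iteratedDeriv_one, e.deriv_eq]
    have := (((hasDerivAt_id (0 : ℂ)).const_add 1).inv (by simp)).sub_const 1
    simpa [Pi.inv_def] using this.deriv
  set w : ℝ := κ / (p + p ^ 2) with hw
  have ev : ∀ᶠ s : ℂ in 𝓝 0, 1 + w * s ^ 2 ∈ Complex.slitPlane := by
    have c : ContinuousAt (fun s : ℂ => 1 + w * s ^ 2) 0 := by fun_prop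
    exact c.eventually_mem (Complex.isOpen_slitPlane.mem_nhds (by simp))
  have hd : ∀ s : ℂ, HasDerivAt (fun s : ℂ => 1 + w * s ^ 2) (2 * w * s) s := by
    intro s
    refine (((hasDerivAt_pow 2 s).const_mul (w : ℂ)).const_add 1).congr_deriv ?_
    simp only [Nat.cast_ofNat, Nat.reduceSub, pow_one]
    ring
  have m0 : deriv (fun s : ℂ => Complex.log (1 + w * s ^ 2)) =ᶠ[𝓝 0]
      fun s => 2 * w * s / (1 + w * s ^ 2) := by
    filter_upwards [ev] with s hs
    exact ((hd s).clog hs).deriv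
  have m1 : deriv (fun s : ℂ => Complex.log (1 + w * s ^ 2)) 0 = 0 := by
    rw [m0.eq_of_nhds]; simp
  have m2 : iteratedDeriv 2 (fun s : ℂ => Complex.log (1 + w * s ^ 2)) 0 = 2 * w := by
    rw [iteratedDeriv_succ', iteratedDeriv_one, m0.deriv_eq]
    have := ((hasDerivAt_id (0 : ℂ)).const_mul (2 * w : ℂ)).fun_div (hd 0) (by simp)
    simpa using this.deriv
  rw [expCoeff_two, ← iteratedDeriv_one, deriv_phase _ _ _ _ two_pos,
    deriv_phase _ _ _ _ one_pos, ← hw, l2, m2, iteratedDeriv_one, iteratedDeriv_one, l1.deriv,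
    iteratedDeriv_one, m1, ← iteratedDeriv_one, iteratedDeriv_logLogQuot,
    iteratedDeriv_logLogQuot]
  have i2 : ∀ a b : ℕ, iteratedDeriv 2 (invPow a b p) 0 =
      -a * iteratedDeriv 1 (invPow (a + 1) b p) 0
        + -(b * p) * iteratedDeriv 1 (invPow (a + 1) (b + 1) p) 0 :=
    fun a b => iteratedDeriv_invPow_succ p a b 1
  simp only [iteratedDeriv_logLog_succ, i2, iteratedDeriv_invPow_succ, iteratedDeriv_invPow_zero]
  push_cast
  ring

/-! ### Bounds for the phase function -/

theorem differentiableOn_logLog {p : ℝ} (hp : |p| ≤ 1) :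
    DifferentiableOn ℂ (logLog p) (Metric.ball 0 (1 / 4)) := by
  intro v hv
  rw [mem_ball_zero_iff] at hv
  exact ((hasDerivAt_one_add_log p (one_add_mem_slitPlane (by linarith))).clog
    (one_add_mem_slitPlane (by linarith [norm_mul_log_le hp hv]))).differentiableAt
    |>.differentiableWithinAt

theorem norm_logLog_le {p : ℝ} (hp : |p| ≤ 1) {v : ℂ} (hv : ‖v‖ < 1 / 4) : ‖logLog p v‖ ≤ 1 := by
  have h := norm_mul_log_le hp hv
  have := Complex.norm_log_one_add_half_le_self h
  rw [logLog]
  linarith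

/-- Schwarz's lemma: $f$ maps the disc of radius $R$ into the closed disc of radius $2B$ around
$f(0)$. -/
theorem norm_dslope_le_of_bound {f : ℂ → ℂ} {R B : ℝ} (hR : 0 < R)
    (hf : DifferentiableOn ℂ f (Metric.ball 0 R)) (hB : ∀ v ∈ Metric.ball (0 : ℂ) R, ‖f v‖ ≤ B) :
    DifferentiableOn ℂ (dslope f 0) (Metric.ball 0 R) ∧
      ∀ v ∈ Metric.ball (0 : ℂ) R, ‖dslope f 0 v‖ ≤ 2 * B / R := by
  refine ⟨(Complex.differentiableOn_dslope (Metric.ball_mem_nhds 0 hR)).mpr hf, fun v hv => ?_⟩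
  refine Complex.norm_dslope_le_div_of_mapsTo_ball hf (fun w hw => ?_) hv
  rw [Metric.mem_closedBall, dist_eq_norm]
  have h1 := hB w hw
  have h2 := hB 0 (Metric.mem_ball_self hR)
  linarith [norm_sub_le (f w) (f 0)]

/-- Three successive divided differences of a function bounded by $1$ on the disc of radius $1/4$
have the bounds $8$, $64$ and $512$. The constant is independent of $p$. -/
theorem logLogQuot_bound {p : ℝ} (hp : |p| ≤ 1) :
    DifferentiableOn ℂ (logLogQuot p) (Metric.ball 0 (1 / 4)) ∧
      ∀ v : ℂ, ‖v‖ < 1 / 4 → ‖logLogQuot p v + ((p + p ^ 2) / 2 : ℝ)‖ ≤ 512 * ‖v‖ := by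
  have hR : (0 : ℝ) < 1 / 4 := by norm_num
  obtain ⟨d1, b1⟩ := norm_dslope_le_of_bound hR (differentiableOn_logLog hp)
    fun v hv => norm_logLog_le hp (by simpa using hv)
  obtain ⟨d2, b2⟩ := norm_dslope_le_of_bound hR d1 b1
  obtain ⟨-, b3⟩ := norm_dslope_le_of_bound hR d2 b2
  refine ⟨d2, fun v hv => ?_⟩
  have h := sub_smul_dslope (logLogQuot p) 0 v
  rw [logLogQuot_zero, sub_neg_eq_add] at h
  rw [← h, sub_zero, norm_smul]
  have := b3 v (by simpa using hv)
  norm_num at this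
  rw [mul_comm]
  gcongr
  exact this

/-- The radius of a disc on which `phase` is bounded by `1`. -/
noncomputable def phaseRadius (κ : ℕ) (p z : ℝ) : ℝ := p / (2000 * (κ + 1) * (1 + |z|) ^ 3)

theorem phaseRadius_pos (κ : ℕ) {p : ℝ} (hp : 0 < p) (z : ℝ) : 0 < phaseRadius κ p z := by
  unfold phaseRadius; positivity

theorem phaseRadius_bounds (κ : ℕ) {p : ℝ} (hp : 0 < p) (hp1 : p ≤ 1) (z : ℝ) {r : ℝ} (hr : 0 ≤ r)
    (h : r ≤ phaseRadius κ p z) :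
    |z| * r ≤ 1 / 2000 ∧ |z| ^ 3 * r ≤ 1 / 2000 ∧ κ * (|z| * r) ≤ 1 / 2000 ∧
      κ * (r / p) ≤ 1 / 2000 ∧ r ≤ 1 / 2000 := by
  set a := |z| with ha
  have ha0 : 0 ≤ a := abs_nonneg z
  have hκ : (0 : ℝ) ≤ κ := by positivity
  rw [phaseRadius, le_div_iff₀ (by positivity)] at h
  have e1 : (κ + 1 : ℝ) * (1 + a) ^ 3 * r ≤ p / 2000 := by linarith
  have k1 : a * r ≤ (κ + 1 : ℝ) * (1 + a) ^ 3 * r := by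
    gcongr
    nlinarith [pow_nonneg ha0 3, pow_nonneg ha0 2, mul_nonneg hκ (pow_nonneg (by linarith : 0 ≤ 1 + a) 3)]
  have k2 : a ^ 3 * r ≤ (κ + 1 : ℝ) * (1 + a) ^ 3 * r := by
    gcongr
    nlinarith [pow_nonneg ha0 3, pow_nonneg ha0 2, mul_nonneg hκ (pow_nonneg (by linarith : 0 ≤ 1 + a) 3)]
  have k3 : κ * (a * r) ≤ (κ + 1 : ℝ) * (1 + a) ^ 3 * r := by
    rw [← mul_assoc]
    gcongr
    · linarith
    · nlinarith [pow_nonneg ha0 3, pow_nonneg ha0 2]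
  have k4 : κ * r ≤ (κ + 1 : ℝ) * (1 + a) ^ 3 * r := by
    gcongr
    nlinarith [pow_nonneg ha0 3, pow_nonneg ha0 2, mul_nonneg hκ (pow_nonneg ha0 3),
      mul_nonneg hκ (pow_nonneg ha0 2), mul_nonneg hκ ha0]
  have k5 : r ≤ (κ + 1 : ℝ) * (1 + a) ^ 3 * r := by
    refine le_mul_of_one_le_left hr ?_
    nlinarith [pow_nonneg ha0 3, pow_nonneg ha0 2, mul_nonneg hκ (pow_nonneg ha0 3),
      mul_nonneg hκ (pow_nonneg ha0 2), mul_nonneg hκ ha0]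
  refine ⟨by linarith, by linarith, by linarith, ?_, by linarith⟩
  rw [← mul_div_assoc, div_le_iff₀ hp]
  linarith

/-- The radius is chosen so that the three summands are at most $512/2000$, $1/2000$ and $1/2000$.
Its factor $p$ absorbs $\kappa/(p+p^2)$, and $(1+|z|)^3$ absorbs the cubic term. -/
theorem phase_bound (κ : ℕ) {p : ℝ} (hp : 0 < p) (hp1 : p ≤ 1) (z : ℝ) :
    DifferentiableOn ℂ (phase κ p z) (Metric.ball 0 (phaseRadius κ p z)) ∧
      ∀ s ∈ Metric.ball (0 : ℂ) (phaseRadius κ p z), ‖phase κ p z s‖ ≤ 1 := by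
  have hpa : |p| ≤ 1 := by rwa [abs_of_pos hp]
  obtain ⟨hd, hb⟩ := logLogQuot_bound hpa
  have key : ∀ s ∈ Metric.ball (0 : ℂ) (phaseRadius κ p z),
      ‖(z : ℂ) * s‖ ≤ 1 / 2000 ∧ ‖((κ / (p + p ^ 2) : ℝ) : ℂ) * s ^ 2‖ ≤ 1 / 2000 := by
    intro s hs
    rw [mem_ball_zero_iff] at hs
    obtain ⟨b1, -, -, b4, b5⟩ := phaseRadius_bounds κ hp hp1 z (norm_nonneg s) hs.le
    refine ⟨by rwa [norm_mul, Complex.norm_real, Real.norm_eq_abs], ?_⟩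
    rw [norm_mul, Complex.norm_real, Real.norm_eq_abs, abs_of_nonneg (by positivity), norm_pow]
    calc (κ : ℝ) / (p + p ^ 2) * ‖s‖ ^ 2 ≤ κ / p * (‖s‖ * 1) := by
          rw [sq ‖s‖]
          gcongr
          · nlinarith
          · linarith
      _ = κ * (‖s‖ / p) := by ring
      _ ≤ _ := b4
  constructor
  · intro s hs
    obtain ⟨k1, k2⟩ := key s hs
    have h1 : DifferentiableAt ℂ (fun s : ℂ => logLogQuot p (z * s)) s := by
      refine DifferentiableAt.fun_comp' (g := logLogQuot p) (f := fun s : ℂ => (z : ℂ) * s) s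
        ?_ (by fun_prop)
      exact hd.differentiableAt (Metric.isOpen_ball.mem_nhds (by
        rw [mem_ball_zero_iff]; linarith))
    have h2 : DifferentiableAt ℂ (fun s : ℂ => Complex.log (1 + z * s)) s :=
      DifferentiableAt.clog (by fun_prop) (one_add_mem_slitPlane (by linarith))
    have h3 : DifferentiableAt ℂ
        (fun s : ℂ => Complex.log (1 + (κ / (p + p ^ 2) : ℝ) * s ^ 2)) s :=
      DifferentiableAt.clog (by fun_prop) (one_add_mem_slitPlane (by linarith))
    unfold phase
    apply DifferentiableAt.differentiableWithinAt
    fun_prop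
  · intro s hs
    obtain ⟨k1, k2⟩ := key s hs
    rw [mem_ball_zero_iff] at hs
    obtain ⟨-, b2, b3, -, -⟩ := phaseRadius_bounds κ hp hp1 z (norm_nonneg s) hs.le
    have t1 : ‖(z : ℂ) ^ 2 * (logLogQuot p (z * s) + ((p + p ^ 2) / 2 : ℝ))‖ ≤ 512 / 2000 := by
      have := hb (z * s) (by linarith)
      rw [norm_mul] at this
      rw [norm_mul, norm_pow, Complex.norm_real, Real.norm_eq_abs] at *
      calc _ ≤ |z| ^ 2 * (512 * (|z| * ‖s‖)) := by gcongr
        _ = 512 * (|z| ^ 3 * ‖s‖) := by ring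
        _ ≤ _ := by linarith
    have t2 : ‖(κ : ℂ) * (Complex.log (1 + z * s) - z * s)‖ ≤ 1 / 2000 := by
      have := Complex.norm_log_one_add_sub_self_le (z := z * s) (by linarith)
      have hi : (1 - ‖(z : ℂ) * s‖)⁻¹ ≤ 2 := by
        rw [inv_le_comm₀ (by linarith) (by norm_num)]
        linarith
      rw [norm_mul, Complex.norm_natCast]
      refine le_trans ?_ b3
      gcongr
      have e : ‖(z : ℂ) * s‖ = |z| * ‖s‖ := by rw [norm_mul, Complex.norm_real, Real.norm_eq_abs]
      rw [← e]
      nlinarith [norm_nonneg ((z : ℂ) * s), sq_nonneg ‖(z : ℂ) * s‖]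
    have t3 : ‖(1 / 2 : ℂ) * Complex.log (1 + (κ / (p + p ^ 2) : ℝ) * s ^ 2)‖ ≤ 1 / 2000 := by
      have := Complex.norm_log_one_add_half_le_self
        (z := ((κ / (p + p ^ 2) : ℝ) : ℂ) * s ^ 2) (by linarith)
      rw [norm_mul]
      norm_num at this ⊢
      norm_num at k2
      linarith
    unfold phase
    refine (norm_add₃_le).trans ?_
    linarith

/-! ### The rescaled integrand -/

/-- The integrand `(log y)^n y^κ e^{-c y}` in the variable `z`, `y = y₀ (1 + s z)`, normalized at
the saddle point `y₀`. -/
noncomputable def kern (κ n : ℕ) (p s z : ℝ) : ℝ :=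
  (1 + p * Real.log (1 + s * z)) ^ n * (1 + s * z) ^ κ * Real.exp (-((n * p + κ) * (s * z)))

/-- The range of `z` that corresponds to `y > 1`. -/
def kernDomain (p s : ℝ) : Set ℝ := {z | Real.exp (-1 / p) < 1 + s * z}

theorem measurableSet_kernDomain (p s : ℝ) : MeasurableSet (kernDomain p s) :=
  measurableSet_lt measurable_const (by fun_prop)

theorem kernDomain_pos {p s z : ℝ} (hp : 0 < p) (hz : z ∈ kernDomain p s) :
    0 < 1 + s * z ∧ 0 < 1 + p * Real.log (1 + s * z) := by
  have h1 : 0 < 1 + s * z := (Real.exp_pos _).trans hz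
  refine ⟨h1, ?_⟩
  have h2 := (Real.lt_log_iff_exp_lt h1).mpr hz
  rw [div_lt_iff₀ hp] at h2
  linarith

theorem integral_exp_neg_mul_abs {a : ℝ} (ha : 0 < a) :
    ∫ z : ℝ, Real.exp (-(a * |z|)) = 2 / a := by
  rw [integral_comp_abs (f := fun z => Real.exp (-(a * z)))]
  have := integral_exp_mul_Ioi (a := -a) (by linarith) 0
  simp only [neg_mul, mul_zero, Real.exp_zero] at this
  rw [this]
  field_simp

theorem integrable_exp_neg_mul_abs {a : ℝ} (ha : 0 < a) :
    Integrable fun z : ℝ => Real.exp (-(a * |z|)) := by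
  refine Integrable.of_integral_ne_zero ?_
  rw [integral_exp_neg_mul_abs ha]
  positivity

/-- Quadratic near $0$ and linear far away. For $v\ge0$ it follows from $e^x\ge1+x+x^2/2$, and for
$v<0$ from $\log(1+u)\ge 2u/(u+2)$ with $1+u=(1+v)^{-1}$. -/
theorem log_one_add_sub_le {v : ℝ} (hv : -1 < v) :
    Real.log (1 + v) - v ≤ -(min (v ^ 2) |v|) / 6 := by
  rcases le_or_gt 0 v with h | h
  · rw [abs_of_nonneg h]
    set m := min (v ^ 2) v / 6 with hm
    have hmv : m ≤ v / 6 := by rw [hm]; gcongr; exact min_le_right _ _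
    have hmv2 : m ≤ v ^ 2 / 6 := by rw [hm]; gcongr; exact min_le_left _ _
    have hx : 0 ≤ v - m := by linarith
    have key : 1 + v ≤ Real.exp (v - m) := by
      refine le_trans ?_ (Real.quadratic_le_exp_of_nonneg hx)
      -- From $m\le v/6$ one gets $(v-m)^2\ge\frac{25}{36}v^2$, while $2m\le v^2/3$.
      have : 2 * m ≤ (v - m) ^ 2 := by
        have h1 : 5 / 6 * v ≤ v - m := by linarith
        have h2 : (5 / 6 * v) ^ 2 ≤ (v - m) ^ 2 := pow_le_pow_left₀ (by positivity) h1 2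
        nlinarith
      linarith
    have := (Real.log_le_iff_le_exp (by linarith)).mpr key
    linarith
  · have h1 : 0 < 1 + v := by linarith
    have hu : 0 ≤ -v / (1 + v) := by apply div_nonneg <;> linarith
    have h2 := Real.le_log_one_add_of_nonneg hu
    have e1 : 1 + -v / (1 + v) = (1 + v)⁻¹ := by field_simp; ring
    have e2 : 2 * (-v / (1 + v)) / (-v / (1 + v) + 2) = -2 * v / (2 + v) := by
      have : 2 + v ≠ 0 := by linarith
      rw [show -v / (1 + v) + 2 = (2 + v) / (1 + v) by field_simp; ring]
      field_simp
    rw [e1, e2, Real.log_inv] at h2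
    have h3 : v ^ 2 / 6 ≤ -2 * v / (2 + v) + v := by
      rw [← sub_nonneg]
      have : -2 * v / (2 + v) + v - v ^ 2 / 6 = v ^ 2 * (4 - v) / (6 * (2 + v)) := by
        have : 2 + v ≠ 0 := by linarith
        field_simp
        ring
      rw [this]
      apply div_nonneg <;> nlinarith [sq_nonneg v]
    linarith [min_le_left (v ^ 2) |v|]

/-- Both branches of the minimum give the same bound: $n(sz)^2=z^2\ge|z|-1$, and $n|sz|\ge|z|$
because $ns=1/s\ge1$. The resulting exponential decay in $z$ does not depend on $n$. -/
theorem scaled_log_sub_le {n : ℕ} {s z : ℝ} (hs : 0 < s) (hs1 : s ≤ 1) (hn : n * s ^ 2 = 1)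
    (hz : 0 < 1 + s * z) : n * (Real.log (1 + s * z) - s * z) ≤ -(|z| - 1) / 6 := by
  have h := log_one_add_sub_le (v := s * z) (by linarith)
  have h1 : n * min ((s * z) ^ 2) |s * z| ≥ |z| - 1 := by
    rcases min_choice ((s * z) ^ 2) |s * z| with h | h <;> rw [h]
    · have : n * (s * z) ^ 2 = |z| ^ 2 := by rw [sq_abs]; linear_combination z ^ 2 * hn
      rw [this]
      nlinarith [sq_nonneg (|z| - 1), abs_nonneg z]
    · rw [abs_mul, abs_of_pos hs]
      have : 1 ≤ n * s := by nlinarith [(Nat.cast_nonneg n : (0 : ℝ) ≤ n)]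
      nlinarith [abs_nonneg z]
  have hn0 : (0 : ℝ) ≤ n := Nat.cast_nonneg n
  nlinarith

theorem kern_nonneg {κ n : ℕ} {p s z : ℝ} (hp : 0 < p) (hz : z ∈ kernDomain p s) :
    0 ≤ kern κ n p s z := by
  obtain ⟨h1, h2⟩ := kernDomain_pos hp hz
  unfold kern
  positivity

/-- Apply $1+u\le e^u$ to both powers; the contributions of $\kappa$ then cancel against the
exponential. -/
theorem kern_le {κ n : ℕ} {p s z : ℝ} (hp : 0 < p) (hz : z ∈ kernDomain p s) :
    kern κ n p s z ≤ Real.exp (p * (n * (Real.log (1 + s * z) - s * z))) := by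
  obtain ⟨h1, h2⟩ := kernDomain_pos hp hz
  have a1 : (1 + p * Real.log (1 + s * z)) ^ n ≤ Real.exp (n * (p * Real.log (1 + s * z))) := by
    rw [Real.exp_nat_mul]
    gcongr
    linarith [Real.add_one_le_exp (p * Real.log (1 + s * z))]
  have a2 : (1 + s * z) ^ κ ≤ Real.exp (κ * (s * z)) := by
    rw [Real.exp_nat_mul]
    gcongr
    linarith [Real.add_one_le_exp (s * z)]
  calc kern κ n p s z ≤ Real.exp (n * (p * Real.log (1 + s * z))) * Real.exp (κ * (s * z))
        * Real.exp (-((n * p + κ) * (s * z))) := by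
        unfold kern
        gcongr
    _ = _ := by
        rw [← Real.exp_add, ← Real.exp_add]
        congr 1
        ring

theorem kern_le_weight {κ n : ℕ} {p s z : ℝ} (hp : 0 < p) (hp1 : p ≤ 1) (hs : 0 < s) (hs1 : s ≤ 1)
    (hn : n * s ^ 2 = 1) (hz : z ∈ kernDomain p s) :
    kern κ n p s z ≤ Real.exp 1 * Real.exp (-(p / 6 * |z|)) := by
  refine (kern_le hp hz).trans ?_
  rw [← Real.exp_add]
  gcongr
  have := scaled_log_sub_le hs hs1 hn (kernDomain_pos hp hz).1
  nlinarith

theorem gauss_le_weight {p : ℝ} (hp : 0 < p) (hp1 : p ≤ 1) (z : ℝ) :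
    Real.exp (-((p + p ^ 2) / 2) * z ^ 2) ≤ Real.exp 1 * Real.exp (-(p / 6 * |z|)) := by
  rw [← Real.exp_add]
  gcongr
  have h1 : |z| - 1 ≤ z ^ 2 := by
    rw [← sq_abs]
    nlinarith [sq_nonneg (|z| - 1), abs_nonneg z]
  nlinarith [mul_nonneg hp.le (sq_nonneg z), mul_nonneg (sq_nonneg p) (sq_nonneg z),
    mul_le_mul_of_nonneg_left h1 hp.le]

/-- For $|sz|<1/4$ both logarithms have positive real arguments, so the complex phase restricts to
the real exponent, with $n$ eliminated by $ns^2=1$. -/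
theorem ofReal_kern {κ n : ℕ} {p s z : ℝ} (hp : 0 < p) (hp1 : p ≤ 1) (hs : 0 < s)
    (hn : n * s ^ 2 = 1) (hsz : |s * z| < 1 / 4) :
    z ∈ kernDomain p s ∧
    ((√(1 + κ / (p + p ^ 2) * s ^ 2) * kern κ n p s z : ℝ) : ℂ)
      = Real.exp (-((p + p ^ 2) / 2) * z ^ 2) * cexp (phase κ p z s) := by
  have hb := abs_lt.mp hsz
  have h1 : 0 < 1 + s * z := by linarith
  have hlog : -1 / 2 < Real.log (1 + s * z) := by
    rw [Real.lt_log_iff_exp_lt h1]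
    have e : Real.exp (-1 / 2) ≤ 2 / 3 := by
      rw [neg_div, Real.exp_neg, inv_le_comm₀ (Real.exp_pos _) (by norm_num)]
      linarith [Real.add_one_le_exp (1 / 2)]
    linarith
  have hpl : 0 < 1 + p * Real.log (1 + s * z) := by nlinarith
  have hmem : z ∈ kernDomain p s := by
    have : -1 / p ≤ -1 / 2 := by
      rw [div_le_div_iff₀ hp two_pos]; linarith
    exact (Real.lt_log_iff_exp_lt h1).mp (this.trans_lt hlog)
  refine ⟨hmem, ?_⟩
  have hw : 0 < 1 + κ / (p + p ^ 2) * s ^ 2 := by positivity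
  have e1 : Complex.log (1 + z * s) = (Real.log (1 + s * z) : ℝ) := by
    rw [Complex.ofReal_log h1.le]
    push_cast
    ring_nf
  have e2 : logLog p (z * s) = (Real.log (1 + p * Real.log (1 + s * z)) : ℝ) := by
    rw [logLog, e1, Complex.ofReal_log hpl.le]
    push_cast
    rfl
  have e3 : Complex.log (1 + (κ / (p + p ^ 2) : ℝ) * (s : ℂ) ^ 2)
      = (Real.log (1 + κ / (p + p ^ 2) * s ^ 2) : ℝ) := by
    rw [Complex.ofReal_log hw.le]
    push_cast
    rfl
  have e4 : (z : ℂ) ^ 2 * logLogQuot p (z * s)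
      = n * ((Real.log (1 + p * Real.log (1 + s * z)) : ℝ) - p * (z * s)) := by
    have h := sq_mul_logLogQuot p (z * s)
    rw [e2] at h
    have hn' : (n : ℂ) * s ^ 2 = 1 := by exact_mod_cast hn
    rw [← h]
    linear_combination (-(z : ℂ) ^ 2 * logLogQuot p (z * s)) * hn'
  have e5 : phase κ p z s = ((n * (Real.log (1 + p * Real.log (1 + s * z)) - p * (z * s))
      + z ^ 2 * ((p + p ^ 2) / 2) + κ * (Real.log (1 + s * z) - z * s)
      + Real.log (1 + κ / (p + p ^ 2) * s ^ 2) / 2 : ℝ) : ℂ) := by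
    rw [phase, mul_add, e4, e1, e3]
    push_cast
    ring
  rw [e5, ← Complex.ofReal_exp, ← Complex.ofReal_mul]
  congr 1
  obtain ⟨r, hr⟩ : ∃ r, Real.log √(1 + κ / (p + p ^ 2) * s ^ 2) = r := ⟨_, rfl⟩
  have a1 : √(1 + κ / (p + p ^ 2) * s ^ 2) = Real.exp r := by
    rw [← hr, Real.exp_log (Real.sqrt_pos.mpr hw)]
  have a2 : (1 + p * Real.log (1 + s * z)) ^ n
      = Real.exp (n * Real.log (1 + p * Real.log (1 + s * z))) := by
    rw [Real.exp_nat_mul, Real.exp_log hpl]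
  have a3 : (1 + s * z) ^ κ = Real.exp (κ * Real.log (1 + s * z)) := by
    rw [Real.exp_nat_mul, Real.exp_log h1]
  rw [← Real.exp_add, ← Real.log_sqrt hw.le, hr, a1, kern, a2, a3, ← Real.exp_add,
    ← Real.exp_add, ← Real.exp_add]
  congr 1
  ring

theorem sqrt_factor_le (κ : ℕ) {p s : ℝ} (hp : 0 < p) (hp1 : p ≤ 1) (hs : 0 < s) (hs1 : s ≤ 1) :
    √(1 + κ / (p + p ^ 2) * s ^ 2) ≤ (1 + κ) * (1 / p) := by
  have hκ : (0 : ℝ) ≤ κ := Nat.cast_nonneg κ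
  have h1 : κ / (p + p ^ 2) * s ^ 2 ≤ κ / p * 1 := by
    gcongr
    · nlinarith
    · nlinarith
  have h2 : 1 ≤ 1 / p := by rw [le_div_iff₀ hp]; linarith
  have h3 : 1 + κ / (p + p ^ 2) * s ^ 2 ≤ (1 + κ) * (1 / p) := by
    have : (κ : ℝ) / p * 1 = κ * (1 / p) := by ring
    linarith
  have h4 : (1 : ℝ) ≤ (1 + κ) * (1 / p) := by nlinarith
  rw [Real.sqrt_le_left (by linarith)]
  nlinarith

/-- The estimate holds for every real $z$ by splitting according to the size of $s$ relative to the
radius of analyticity, which shrinks as $|z|$ grows. -/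
theorem kern_sub_taylor_le (κ m : ℕ) : ∃ C : ℝ, 0 ≤ C ∧ ∀ (n : ℕ) (p s z : ℝ), 0 < p → p ≤ 1 →
    0 < s → s ≤ 1 → n * s ^ 2 = 1 →
    ‖(kernDomain p s).indicator
        (fun z => ((√(1 + κ / (p + p ^ 2) * s ^ 2) * kern κ n p s z : ℝ) : ℂ)) z
      - Real.exp (-((p + p ^ 2) / 2) * z ^ 2)
        * ∑ i ∈ Finset.range m, expCoeff κ i p z * s ^ i‖
      ≤ C * (s * (1 + |z|) ^ 3 / p) ^ m * (1 / p) * Real.exp (-(p / 6 * |z|)) := by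
  set e := Real.exp 1 with he
  have he0 : 0 < e := Real.exp_pos 1
  refine ⟨(8000 * (κ + 1)) ^ m * (2 * e ^ 2 + (1 + κ) * e + m * e ^ 2), by positivity, ?_⟩
  intro n p s z hp hp1 hs hs1 hn
  set R := phaseRadius κ p z with hR
  have hR0 : 0 < R := phaseRadius_pos κ hp z
  obtain ⟨hd, hb⟩ := phase_bound κ hp hp1 z
  have hdF : DifferentiableOn ℂ (fun s => cexp (phase κ p z s)) (Metric.ball 0 R) := hd.cexp
  have hbF : ∀ s ∈ Metric.ball (0 : ℂ) R, ‖cexp (phase κ p z s)‖ ≤ e := fun s hs => by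
    rw [Complex.norm_exp, he]
    gcongr
    exact (Complex.re_le_norm _).trans (hb s hs)
  have hρ : 0 < R / 2 := by linarith
  have hρR : R / 2 < R := by linarith
  set t := s / (R / 2) with ht
  have ht0 : 0 ≤ t := by positivity
  -- Since $t=2s/R$, the constant $8000$ is $4\cdot2000$.
  have htm : (2 * t) ^ m = (8000 * (κ + 1)) ^ m * (s * (1 + |z|) ^ 3 / p) ^ m := by
    rw [← mul_pow, ht, hR, phaseRadius]
    congr 1
    field_simp
    norm_num
  have hp' : 1 ≤ 1 / p := by rw [le_div_iff₀ hp]; linarith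
  set W := Real.exp (-(p / 6 * |z|)) with hW
  have hW0 : 0 < W := Real.exp_pos _
  set G := Real.exp (-((p + p ^ 2) / 2) * z ^ 2) with hG
  have hG0 : 0 < G := Real.exp_pos _
  have hGW : G ≤ e * W := gauss_le_weight hp hp1 z
  have hgoal : ((2 * t) ^ m * (2 * e ^ 2 + (1 + κ) * e + m * e ^ 2)) * ((1 / p) * W)
      = (8000 * (κ + 1)) ^ m * (2 * e ^ 2 + (1 + κ) * e + m * e ^ 2)
        * (s * (1 + |z|) ^ 3 / p) ^ m * (1 / p) * W := by
    rw [htm]; ring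
  rw [← hgoal]
  have hWp : W ≤ 1 / p * W := le_mul_of_one_le_left hW0.le hp'
  -- For $t\le1/2$ the point $s$ lies well inside the disc and the Taylor remainder estimate
  -- applies.
  rcases le_or_gt t (1 / 2) with h | h
  · have hsR : s ≤ R / 2 / 2 := by
      rw [ht, div_le_iff₀ hρ] at h
      linarith
    have hsz : |s * z| < 1 / 4 := by
      have := (phaseRadius_bounds κ hp hp1 z hs.le (show s ≤ phaseRadius κ p z by linarith)).1
      rw [abs_mul, abs_of_pos hs]
      linarith
    obtain ⟨hm, hk⟩ := ofReal_kern (κ := κ) hp hp1 hs hn hsz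
    rw [Set.indicator_of_mem hm, hk, ← mul_sub, norm_mul, Complex.norm_real, Real.norm_eq_abs,
      abs_of_pos hG0]
    have hns : ‖(s : ℂ)‖ = s := by rw [Complex.norm_real, Real.norm_eq_abs, abs_of_pos hs]
    have hrem := norm_taylor_remainder_le hρ hρR hdF hbF (s := (s : ℂ)) (by rw [hns]; exact hsR) m
    rw [hns, ← ht] at hrem
    have htt : t ^ m ≤ (2 * t) ^ m := by gcongr; linarith
    calc _ ≤ (e * W) * (2 * e * (2 * t) ^ m) := by
          gcongr
          exact hrem.trans (by gcongr)
      _ = (2 * t) ^ m * (2 * e ^ 2 + 0 + 0) * W := by ring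
      _ ≤ _ := by gcongr <;> positivity
  -- Here $(2t)^m\ge1$, so no cancellation is needed: the integrand and the Taylor polynomial are
  -- bounded separately by the common weight.
  · have hone : 1 ≤ 2 * t := by linarith
    have h1 : ‖(kernDomain p s).indicator
        (fun z => ((√(1 + κ / (p + p ^ 2) * s ^ 2) * kern κ n p s z : ℝ) : ℂ)) z‖
        ≤ (1 + κ) * e * (1 / p * W) := by
      by_cases hm : z ∈ kernDomain p s
      · rw [Set.indicator_of_mem hm, Complex.norm_real, Real.norm_eq_abs,
          abs_of_nonneg (mul_nonneg (Real.sqrt_nonneg _) (kern_nonneg hp hm))]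
        calc _ ≤ ((1 + κ) * (1 / p)) * (e * W) := by
              gcongr
              · exact kern_nonneg hp hm
              · exact sqrt_factor_le κ hp hp1 hs hs1
              · exact kern_le_weight hp hp1 hs hs1 hn hm
          _ = _ := by ring
      · rw [Set.indicator_of_notMem hm, norm_zero]
        positivity
    have h2 : ‖(G : ℂ) * ∑ i ∈ Finset.range m, expCoeff κ i p z * (s : ℂ) ^ i‖
        ≤ m * e ^ 2 * (2 * t) ^ m * (1 / p * W) := by
      rw [norm_mul, Complex.norm_real, Real.norm_eq_abs, abs_of_pos hG0]
      have hs' : ‖∑ i ∈ Finset.range m, expCoeff κ i p z * (s : ℂ) ^ i‖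
          ≤ m * (e * (2 * t) ^ m) := by
        refine (norm_sum_le_of_le _ (fun i hi => ?_)).trans
          (by rw [Finset.sum_const, Finset.card_range, nsmul_eq_mul])
        rw [Finset.mem_range] at hi
        have hc := norm_taylor_coeff_le hρ hρR hdF hbF i
        rw [norm_mul, norm_pow, Complex.norm_real, Real.norm_eq_abs, abs_of_pos hs]
        calc _ ≤ e / (R / 2) ^ i * s ^ i := by gcongr; exact hc
          _ = e * t ^ i := by
            rw [ht, div_pow s, div_mul_eq_mul_div, mul_div_assoc']
          _ ≤ e * (2 * t) ^ i := by gcongr; linarith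
          _ ≤ e * (2 * t) ^ m := by gcongr
      calc _ ≤ (e * W) * (m * (e * (2 * t) ^ m)) := by gcongr
        _ = m * e ^ 2 * (2 * t) ^ m * W := by ring
        _ ≤ _ := by gcongr
    refine (norm_sub_le _ _).trans ((add_le_add h1 h2).trans ?_)
    have h3 : (1 : ℝ) ≤ (2 * t) ^ m := one_le_pow₀ hone
    calc _ = (1 * ((1 + κ) * e) + (2 * t) ^ m * (m * e ^ 2)) * (1 / p * W) := by ring
      _ ≤ ((2 * t) ^ m * (2 * e ^ 2 + (1 + κ) * e) + (2 * t) ^ m * (m * e ^ 2)) * (1 / p * W) := by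
          gcongr
          · nlinarith [sq_nonneg e]
      _ = _ := by ring

/-- Half of the exponential decay is spent on the polynomial factor, at the price of $(1/p)^k$. -/
theorem one_add_abs_pow_mul_weight_le (k : ℕ) {p : ℝ} (hp : 0 < p) (hp1 : p ≤ 1) (z : ℝ) :
    (1 + |z|) ^ k * Real.exp (-(p / 6 * |z|))
      ≤ k.factorial * 12 ^ k * Real.exp 1 * (1 / p) ^ k * Real.exp (-(p / 12 * |z|)) := by
  have h := Real.pow_div_factorial_le_exp (x := p / 12 * (1 + |z|)) (by positivity) k
  have hk : (0 : ℝ) < k.factorial := by exact_mod_cast k.factorial_pos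
  rw [div_le_iff₀ hk] at h
  have e1 : (1 + |z|) ^ k = (p / 12 * (1 + |z|)) ^ k * (12 ^ k * (1 / p) ^ k) := by
    rw [← mul_pow, ← mul_pow]
    congr 1
    field_simp
  have e2 : Real.exp (p / 12 * (1 + |z|)) * Real.exp (-(p / 6 * |z|))
      ≤ Real.exp 1 * Real.exp (-(p / 12 * |z|)) := by
    rw [← Real.exp_add, ← Real.exp_add]
    exact Real.exp_le_exp.mpr (by nlinarith)
  rw [e1]
  calc _ = (p / 12 * (1 + |z|)) ^ k * (12 ^ k * (1 / p) ^ k * Real.exp (-(p / 6 * |z|))) := by ring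
    _ ≤ (Real.exp (p / 12 * (1 + |z|)) * k.factorial)
        * (12 ^ k * (1 / p) ^ k * Real.exp (-(p / 6 * |z|))) := by gcongr
    _ = k.factorial * 12 ^ k * (1 / p) ^ k
        * (Real.exp (p / 12 * (1 + |z|)) * Real.exp (-(p / 6 * |z|))) := by ring
    _ ≤ k.factorial * 12 ^ k * (1 / p) ^ k * (Real.exp 1 * Real.exp (-(p / 12 * |z|))) := by gcongr
    _ = _ := by ring

theorem measurable_kern (κ n : ℕ) (p s : ℝ) : Measurable (kern κ n p s) := by
  unfold kern
  fun_prop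

theorem integrableOn_kern {κ n : ℕ} {p s : ℝ} (hp : 0 < p) (hp1 : p ≤ 1) (hs : 0 < s) (hs1 : s ≤ 1)
    (hn : n * s ^ 2 = 1) : IntegrableOn (kern κ n p s) (kernDomain p s) := by
  have h := ((integrable_exp_neg_mul_abs (a := p / 6) (by positivity)).const_mul
    (Real.exp 1)).integrableOn (s := kernDomain p s)
  refine Integrable.mono' h (measurable_kern κ n p s).aestronglyMeasurable ?_
  filter_upwards [ae_restrict_mem (measurableSet_kernDomain p s)] with z hz
  rw [Real.norm_eq_abs, abs_of_nonneg (kern_nonneg hp hz)]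
  exact kern_le_weight hp hp1 hs hs1 hn hz

/-! ### The Laplace expansion of the rescaled integral -/

theorem one_div_invQuad (x : {x : ℝ // 0 < x}) :
    1 / invQuad x = invHalf x + invHalf x ^ 2 := by
  rw [invQuad, one_div_one_div]

/-- The Gaussian integral of the `i`-th Taylor coefficient. -/
noncomputable def gaussCoeff (κ i : ℕ) (p : ℝ) : ℂ :=
  ∫ z : ℝ, expCoeff κ i p z * Real.exp (-((p + p ^ 2) / 2) * z ^ 2)

theorem integrable_expCoeff (κ i : ℕ) {p : ℝ} (hp : 0 < p) :
    Integrable fun z : ℝ => expCoeff κ i p z * Real.exp (-((p + p ^ 2) / 2) * z ^ 2) := by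
  have h := (polyFun_gaussian (expCoeff_mem κ i)).1 ⟨2 / p, by positivity⟩
  have e : invHalf ⟨2 / p, by positivity⟩ = p := by simp [invHalf]
  simpa only [one_div_invQuad, e] using h

theorem gaussCoeff_odd (κ : ℕ) {i : ℕ} (hi : Odd i) (p : ℝ) : gaussCoeff κ i p = 0 := by
  have h := integral_neg_eq_self
    (fun z : ℝ => expCoeff κ i p z * Real.exp (-((p + p ^ 2) / 2) * z ^ 2)) volume
  simp only [expCoeff_neg, hi.neg_one_pow, even_two, Even.neg_pow, neg_mul,
    one_mul, integral_neg] at h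
  simp only [gaussCoeff, neg_mul]
  linear_combination (-1 / 2 : ℂ) * h

theorem gaussCoeff_zero (κ : ℕ) {p : ℝ} (hp : 0 < p) :
    gaussCoeff κ 0 p = √(2 * π / (p + p ^ 2)) := by
  have := gaussian_moment_zero (q := p + p ^ 2) (by positivity)
  simp only [pow_zero, one_mul] at this
  simp only [gaussCoeff, expCoeff_zero, one_mul]
  rw [integral_complex_ofReal, this]

/-- The $\kappa$-terms cancel, because $-\frac\kappa2z^2$ integrates to $-\frac{\kappa}{2q}$ times
the total mass. Hence $b_1$ does not depend on the weight. -/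
theorem gaussCoeff_two (κ : ℕ) {p : ℝ} (hp : 0 < p) :
    gaussCoeff κ 2 p = ((√(2 * π / (p + p ^ 2)) *
      (5 * (p * (2 + 3 * p + 2 * p ^ 2)) ^ 2 / (24 * (p + p ^ 2) ^ 3)
        - p * (6 + 11 * p + 12 * p ^ 2 + 6 * p ^ 3) / (8 * (p + p ^ 2) ^ 2)) : ℝ) : ℂ) := by
  set q := p + p ^ 2 with hq
  have hq0 : 0 < q := by positivity
  have m0 := gaussian_moment_zero hq0
  have m2 := gaussian_moment_succ hq0 0
  have m4 := gaussian_moment_succ hq0 2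
  have m6 := gaussian_moment_succ hq0 4
  have i := fun m => integrable_pow_mul_gaussian (b := q / 2) (by positivity) m
  set A := (p * (2 + 3 * p + 2 * p ^ 2)) ^ 2 / 72 with hA
  set B := p * (6 + 11 * p + 12 * p ^ 2 + 6 * p ^ 3) / 24 with hB
  have e : ∀ z : ℝ, expCoeff κ 2 p z * Real.exp (-(q / 2) * z ^ 2)
      = ((A * (z ^ 6 * Real.exp (-(q / 2) * z ^ 2)) - B * (z ^ 4 * Real.exp (-(q / 2) * z ^ 2))
        - κ / 2 * (z ^ 2 * Real.exp (-(q / 2) * z ^ 2))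
        + κ / q / 2 * (z ^ 0 * Real.exp (-(q / 2) * z ^ 2)) : ℝ) : ℂ) := by
    intro z
    rw [expCoeff_two_eq, ← hA, ← hB, ← hq, ← Complex.ofReal_mul]
    congr 1
    ring
  rw [gaussCoeff, ← hq]
  simp_rw [e]
  have j1 : Integrable fun z : ℝ => A * (z ^ 6 * Real.exp (-(q / 2) * z ^ 2))
      - B * (z ^ 4 * Real.exp (-(q / 2) * z ^ 2)) := ((i 6).const_mul A).sub ((i 4).const_mul B)
  have j2 : Integrable fun z : ℝ => A * (z ^ 6 * Real.exp (-(q / 2) * z ^ 2))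
      - B * (z ^ 4 * Real.exp (-(q / 2) * z ^ 2))
      - κ / 2 * (z ^ 2 * Real.exp (-(q / 2) * z ^ 2)) := j1.sub ((i 2).const_mul _)
  rw [integral_complex_ofReal, integral_add j2 ((i 0).const_mul _),
    integral_sub j1 ((i 2).const_mul _),
    integral_sub ((i 6).const_mul A) ((i 4).const_mul B), integral_const_mul, integral_const_mul,
    integral_const_mul, integral_const_mul, m6, m4, m2, m0]
  congr 1
  rw [hA, hB]
  push_cast
  field_simp
  ring

/-- The first correction to the leading term. -/
noncomputable def firstCorrection : RatFunc ℚ :=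
  (RatFunc.X ^ 4 + 9 * RatFunc.X ^ 3 + 32 * RatFunc.X ^ 2 + 24 * RatFunc.X + 16)
    / (24 * (RatFunc.X + 2) ^ 3)

theorem firstCorrection_eval {x : ℝ} (hx : 0 < x) :
    firstCorrection.eval (algebraMap ℚ ℝ) x
      = (x ^ 4 + 9 * x ^ 3 + 32 * x ^ 2 + 24 * x + 16) / (24 * (x + 2) ^ 3) := by
  have h := (ratFunc_eval_div (Polynomial.X ^ 4 + 9 * Polynomial.X ^ 3 + 32 * Polynomial.X ^ 2
    + 24 * Polynomial.X + 16) (24 * (Polynomial.X + 2) ^ 3) (x := x) (by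
      simp [Polynomial.eval₂_mul, Polynomial.eval₂_ofNat, Polynomial.eval₂_pow]
      positivity)).2
  have e : algebraMap (Polynomial ℚ) (RatFunc ℚ) (Polynomial.X ^ 4 + 9 * Polynomial.X ^ 3
      + 32 * Polynomial.X ^ 2 + 24 * Polynomial.X + 16)
      / algebraMap (Polynomial ℚ) (RatFunc ℚ) (24 * (Polynomial.X + 2) ^ 3) = firstCorrection := by
    have h (m : ℕ) [m.AtLeastTwo] : algebraMap (Polynomial ℚ) (RatFunc ℚ) (OfNat.ofNat m)
        = OfNat.ofNat m := map_ofNat _ m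
    simp only [firstCorrection, map_add, map_mul, map_pow, RatFunc.algebraMap_X, h]
  rw [e] at h
  rw [h]
  simp [Polynomial.eval₂_mul, Polynomial.eval₂_ofNat, Polynomial.eval₂_pow, Polynomial.eval₂_add]

theorem exists_gaussCoeff_eq (κ j : ℕ) : ∃ r : RatFunc ℚ, (j = 1 → r = firstCorrection) ∧
    ∀ x : ℝ, 0 < x → gaussCoeff κ (2 * j) (2 / x)
      = ((√(2 * π / (2 / x + (2 / x) ^ 2)) * r.eval (algebraMap ℚ ℝ) x : ℝ) : ℂ) := by
  -- The general argument only produces some rational function, so index $1$ is treated separately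
  -- in order to prescribe it.
  rcases eq_or_ne j 1 with rfl | hj
  · refine ⟨firstCorrection, fun _ => rfl, fun x hx => ?_⟩
    rw [mul_one, gaussCoeff_two κ (by positivity), firstCorrection_eval hx]
    congr 2
    field_simp
    ring
  · obtain ⟨-, g, ⟨r, hr⟩, h⟩ := polyFun_gaussian (expCoeff_mem κ (2 * j))
    refine ⟨r, fun h => absurd h hj, fun x hx => ?_⟩
    have := h ⟨x, hx⟩
    simp only [one_div_invQuad, ← (hr _).2] at this
    rw [gaussCoeff, Complex.ofReal_mul]
    exact this

/-- The exponent $4m+2$ collects $m+1$ factors $1/p$ from the pointwise bound, $3m$ from the weight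
$(1+|z|)^{3m}$ and one from $\int e^{-p|z|/12}\,dz=24/p$. -/
theorem norm_integral_kern_sub_le (κ m : ℕ) : ∃ C : ℝ, 0 ≤ C ∧ ∀ (n : ℕ) (p s : ℝ), 0 < p →
    p ≤ 1 → 0 < s → s ≤ 1 → n * s ^ 2 = 1 →
    ‖((√(1 + κ / (p + p ^ 2) * s ^ 2) * ∫ z in kernDomain p s, kern κ n p s z : ℝ) : ℂ)
      - ∑ i ∈ Finset.range m, gaussCoeff κ i p * s ^ i‖ ≤ C * s ^ m * (1 / p) ^ (4 * m + 2) := by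
  obtain ⟨C, hC, h⟩ := kern_sub_taylor_le κ m
  refine ⟨C * ((3 * m).factorial * 12 ^ (3 * m) * Real.exp 1) * 24, by positivity, ?_⟩
  intro n p s hp hp1 hs hs1 hn
  have hmeas := measurableSet_kernDomain p s
  have i1 : Integrable ((kernDomain p s).indicator
      (fun z => ((√(1 + κ / (p + p ^ 2) * s ^ 2) * kern κ n p s z : ℝ) : ℂ))) := by
    rw [integrable_indicator_iff hmeas]
    exact ((integrableOn_kern hp hp1 hs hs1 hn).const_mul _).ofReal
  have i2 : ∀ i, Integrable fun z : ℝ =>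
      expCoeff κ i p z * Real.exp (-((p + p ^ 2) / 2) * z ^ 2) * (s : ℂ) ^ i :=
    fun i => (integrable_expCoeff κ i hp).mul_const _
  have e1 : ((√(1 + κ / (p + p ^ 2) * s ^ 2) * ∫ z in kernDomain p s, kern κ n p s z : ℝ) : ℂ)
      = ∫ z, (kernDomain p s).indicator
        (fun z => ((√(1 + κ / (p + p ^ 2) * s ^ 2) * kern κ n p s z : ℝ) : ℂ)) z := by
    rw [integral_indicator hmeas, integral_complex_ofReal, integral_const_mul]
  have e2 : ∑ i ∈ Finset.range m, gaussCoeff κ i p * (s : ℂ) ^ i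
      = ∫ z : ℝ, ∑ i ∈ Finset.range m,
        expCoeff κ i p z * Real.exp (-((p + p ^ 2) / 2) * z ^ 2) * (s : ℂ) ^ i := by
    rw [integral_finsetSum _ fun i _ => i2 i]
    simp only [gaussCoeff, integral_mul_const]
  rw [e1, e2, ← integral_sub i1 (integrable_finsetSum _ fun i _ => i2 i)]
  have hb := (integrable_exp_neg_mul_abs (a := p / 12) (by positivity)).const_mul
    (C * ((3 * m).factorial * 12 ^ (3 * m) * Real.exp 1) * s ^ m * (1 / p) ^ (4 * m + 1))
  refine (norm_integral_le_of_norm_le hb (.of_forall fun z => ?_)).trans (le_of_eq ?_)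
  · have h1 := h n p s z hp hp1 hs hs1 hn
    rw [Finset.mul_sum] at h1
    have e3 : ∑ i ∈ Finset.range m,
        expCoeff κ i p z * Real.exp (-((p + p ^ 2) / 2) * z ^ 2) * (s : ℂ) ^ i
        = ∑ i ∈ Finset.range m,
          Real.exp (-((p + p ^ 2) / 2) * z ^ 2) * (expCoeff κ i p z * (s : ℂ) ^ i) :=
      Finset.sum_congr rfl fun i _ => by ring
    rw [e3]
    refine h1.trans ?_
    have h2 := one_add_abs_pow_mul_weight_le (3 * m) hp hp1 z
    calc _ = C * s ^ m * (1 / p) ^ (m + 1) * ((1 + |z|) ^ (3 * m) * Real.exp (-(p / 6 * |z|))) := by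
          rw [div_eq_mul_one_div _ p, mul_pow, mul_pow, ← pow_mul]
          ring
      _ ≤ C * s ^ m * (1 / p) ^ (m + 1) * ((3 * m).factorial * 12 ^ (3 * m) * Real.exp 1
          * (1 / p) ^ (3 * m) * Real.exp (-(p / 12 * |z|))) := by gcongr
      _ = _ := by ring
  · rw [integral_const_mul, integral_exp_neg_mul_abs (by positivity),
      show 2 / (p / 12) = 24 * (1 / p) by field_simp; norm_num]
    ring

theorem sum_range_two_mul (a : ℕ → ℂ) (m : ℕ) :
    ∑ i ∈ Finset.range (2 * m), a i = ∑ j ∈ Finset.range m, (a (2 * j) + a (2 * j + 1)) := by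
  induction m with
  | zero => simp
  | succ m ih => rw [Finset.sum_range_succ, ← ih, mul_add, mul_one, Finset.sum_range_succ,
      Finset.sum_range_succ]; ring

/-- The coefficients of the expansion of the Laplace integral. -/
theorem exists_laplace_expansion (κ : ℕ) : ∃ b : ℕ → RatFunc ℚ, b 1 = firstCorrection ∧
    ∀ J : ℕ, ∃ C : ℝ, 0 ≤ C ∧ ∃ M : ℕ, ∀ (n : ℕ) (x s : ℝ), 2 ≤ x → 0 < s → s ≤ 1 →
      n * s ^ 2 = 1 →
      |√((2 / x + (2 / x) ^ 2) / (2 * π)) * (√(1 + κ / (2 / x + (2 / x) ^ 2) * s ^ 2)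
          * ∫ z in kernDomain (2 / x) s, kern κ n (2 / x) s z)
        - (1 + ∑ j ∈ Finset.Icc 1 J, (b j).eval (algebraMap ℚ ℝ) x / (n : ℝ) ^ j)|
      ≤ C * s ^ (2 * (J + 1)) * x ^ M := by
  choose b hb1 hb using exists_gaussCoeff_eq κ
  refine ⟨b, hb1 1 rfl, fun J => ?_⟩
  -- Expanding to order $2(J+1)$ in $s$ gives the terms up to $n^{-J}$ and an error of order
  -- $s^{2(J+1)}=n^{-(J+1)}$.
  obtain ⟨C, hC, h⟩ := norm_integral_kern_sub_le κ (2 * (J + 1))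
  refine ⟨C, hC, 4 * (2 * (J + 1)) + 2, fun n x s hx hs hs1 hn => ?_⟩
  have hx0 : 0 < x := by linarith
  have hp0 : 0 < 2 / x := by positivity
  have hp1 : 2 / x ≤ 1 := by rw [div_le_one hx0]; exact hx
  have h1 := h n (2 / x) s hp0 hp1 hs hs1 hn
  set q := 2 / x + (2 / x) ^ 2 with hq
  have hq0 : 0 < q := by positivity
  set K := √(1 + κ / q * s ^ 2) * ∫ z in kernDomain (2 / x) s, kern κ n (2 / x) s z with hK
  have hs2 : s ^ 2 = 1 / n := by
    rw [eq_div_iff (by rintro h0; simp [h0] at hn)]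
    linarith
  have h0 : gaussCoeff κ 0 (2 / x) = √(2 * π / q) := gaussCoeff_zero κ hp0
  have hb0 : ((√(2 * π / q) : ℝ) : ℂ)
      = ((√(2 * π / q) * (b 0).eval (algebraMap ℚ ℝ) x : ℝ) : ℂ) := h0.symm.trans (hb 0 x hx0)
  have hsum : ∑ i ∈ Finset.range (2 * (J + 1)), gaussCoeff κ i (2 / x) * (s : ℂ) ^ i
      = ((√(2 * π / q) * (1 + ∑ j ∈ Finset.Icc 1 J,
        (b j).eval (algebraMap ℚ ℝ) x / (n : ℝ) ^ j) : ℝ) : ℂ) := by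
    rw [sum_range_two_mul, Finset.sum_range_succ',
      show Finset.Icc 1 J = Finset.Ico 1 (J + 1) by rfl, Finset.sum_Ico_eq_sum_range]
    have hodd : ∀ j, gaussCoeff κ (2 * j + 1) (2 / x) = 0 := fun j =>
      gaussCoeff_odd κ (odd_two_mul_add_one j) _
    have hs2' : (s : ℂ) ^ 2 = 1 / n := by
      rw [← Complex.ofReal_pow, hs2]; simp
    simp only [hodd, zero_mul, add_zero, pow_mul, hs2', hb _ x hx0, ← hq]
    rw [← hb0, pow_zero]
    push_cast
    rw [mul_add, Finset.mul_sum, add_comm, mul_one]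
    congr 1
    refine Finset.sum_congr rfl fun j _ => ?_
    rw [add_comm 1 j, div_pow, one_pow]
    ring
  rw [hsum, ← Complex.ofReal_sub, Complex.norm_real, Real.norm_eq_abs] at h1
  have hinv : √(q / (2 * π)) * √(2 * π / q) = 1 := by
    rw [← Real.sqrt_mul (by positivity), show q / (2 * π) * (2 * π / q) = 1 by field_simp,
      Real.sqrt_one]
  have hle : √(q / (2 * π)) ≤ 1 := by
    refine Real.sqrt_le_one.mpr ?_
    rw [div_le_one (by positivity)]
    nlinarith [Real.pi_gt_three]
  calc _ = |√(q / (2 * π)) * (K - √(2 * π / q) * (1 + ∑ j ∈ Finset.Icc 1 J,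
        (b j).eval (algebraMap ℚ ℝ) x / (n : ℝ) ^ j))| := by
        rw [mul_sub, ← mul_assoc (√(q / (2 * π))) (√(2 * π / q)), hinv, one_mul]
    _ = √(q / (2 * π)) * |K - √(2 * π / q) * (1 + ∑ j ∈ Finset.Icc 1 J,
        (b j).eval (algebraMap ℚ ℝ) x / (n : ℝ) ^ j)| := by
        rw [abs_mul, abs_of_nonneg (Real.sqrt_nonneg _)]
    _ ≤ 1 * (C * s ^ (2 * (J + 1)) * (1 / (2 / x)) ^ (4 * (2 * (J + 1)) + 2)) := by gcongr
    _ ≤ 1 * (C * s ^ (2 * (J + 1)) * x ^ (4 * (2 * (J + 1)) + 2)) := by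
        gcongr
        rw [one_div_div]
        linarith
    _ = _ := one_mul _

/-! ### The Laplace integral in the original variable -/

theorem image_kernDomain {p s : ℝ} (hs : 0 < s) :
    (fun z => Real.exp (1 / p) * (1 + s * z)) '' kernDomain p s = Set.Ioi 1 := by
  have h1 : Real.exp (1 / p) * Real.exp (-1 / p) = 1 := by
    rw [← Real.exp_add, ← add_div, add_neg_cancel, zero_div, Real.exp_zero]
  have h0 := Real.exp_pos (1 / p)
  ext y
  simp only [Set.mem_image, Set.mem_Ioi, kernDomain, Set.mem_ofPred_eq]
  constructor
  · rintro ⟨z, hz, rfl⟩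
    have := mul_lt_mul_of_pos_left hz h0
    rwa [h1] at this
  · intro hy
    refine ⟨(y / Real.exp (1 / p) - 1) / s, ?_, ?_⟩
    · rw [mul_div_cancel₀ _ hs.ne', add_sub_cancel, lt_div_iff₀ h0, mul_comm, h1]
      exact hy
    · rw [mul_div_cancel₀ _ hs.ne', add_sub_cancel, mul_div_cancel₀ _ h0.ne']

/-- The hypothesis `hc` is the saddle point equation for $y_0=e^{1/p}$; it turns $e^{-cy}$ into
$e^{-(np+\kappa)}e^{-(np+\kappa)sz}$. The factor `g` allows for the higher Fourier terms. -/
theorem integral_eq_integral_kern (κ n : ℕ) {c p s : ℝ} (hp : 0 < p) (hs : 0 < s)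
    (hc : c * Real.exp (1 / p) = n * p + κ) (g : ℝ → ℂ) :
    ∫ y in Set.Ioi (1 : ℝ), ((Real.log y ^ n * y ^ κ * Real.exp (-(c * y)) : ℝ) : ℂ) * g y
      = (((1 / p) ^ n * Real.exp (1 / p) ^ (κ + 1) * Real.exp (-(n * p + κ)) * s : ℝ) : ℂ)
        * ∫ z in kernDomain p s, (kern κ n p s z : ℂ) * g (Real.exp (1 / p) * (1 + s * z)) := by
  set E := Real.exp (1 / p) with hE
  have hE0 : 0 < E := Real.exp_pos _
  rw [← image_kernDomain (p := p) hs, integral_image_eq_integral_abs_deriv_smul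
    (f' := fun _ => E * s) (measurableSet_kernDomain p s), ← integral_const_mul]
  · refine setIntegral_congr_fun (measurableSet_kernDomain p s) fun z hz => ?_
    obtain ⟨h1, h2⟩ := kernDomain_pos hp hz
    have hlog : Real.log (E * (1 + s * z)) = 1 / p * (1 + p * Real.log (1 + s * z)) := by
      rw [Real.log_mul hE0.ne' h1.ne', hE, Real.log_exp]
      field_simp
    have hexp : Real.exp (-(c * (E * (1 + s * z))))
        = Real.exp (-(n * p + κ)) * Real.exp (-((n * p + κ) * (s * z))) := by
      rw [← Real.exp_add, ← mul_assoc, hc]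
      congr 1
      ring
    simp only [← hE]
    have e : E * s * ((1 / p * (1 + p * Real.log (1 + s * z))) ^ n * (E * (1 + s * z)) ^ κ
        * (Real.exp (-(n * p + κ)) * Real.exp (-((n * p + κ) * (s * z)))))
        = ((1 / p) ^ n * E ^ (κ + 1) * Real.exp (-(n * p + κ)) * s) * kern κ n p s z := by
      rw [kern, mul_pow, mul_pow]
      ring
    rw [hlog, hexp, abs_of_pos (mul_pos hE0 hs), Complex.real_smul, ← mul_assoc,
      ← Complex.ofReal_mul, e, Complex.ofReal_mul, mul_assoc]
  · intro z _
    have := (((hasDerivAt_id z).const_mul s).const_add 1).const_mul E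
    simpa only [id, mul_one] using this.hasDerivWithinAt
  · intro z _ w _ h
    have h' : E * (1 + s * z) = E * (1 + s * w) := h
    have := mul_left_cancel₀ hE0.ne' h'
    exact mul_left_cancel₀ hs.ne' (add_left_cancel this)

/-- The additional $e^{-cy}$ is weak for $y$ far below the saddle point, where the kernel itself is
small. Half of the kernel's decay is used there, and the other half supplies integrability in $z$.
-/
theorem kern_mul_exp_le {κ n : ℕ} {p s z : ℝ} (hp : 0 < p) (hp1 : p ≤ 1) (hs : 0 < s) (hs1 : s ≤ 1)
    (hn : n * s ^ 2 = 1) (hz : z ∈ kernDomain p s) :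
    kern κ n p s z * Real.exp (-((n * p + κ) * (1 + s * z)))
      ≤ Real.exp (-(n * p / 2)) * (Real.exp 1 * Real.exp (-(p / 12 * |z|))) := by
  have h1 := (kernDomain_pos hp hz).1
  have hn0 : (0 : ℝ) ≤ n := Nat.cast_nonneg n
  have hκ0 : (0 : ℝ) ≤ κ := Nat.cast_nonneg κ
  have h3 : 1 ≤ Real.log 3 := by
    rw [Real.le_log_iff_exp_le (by norm_num)]
    linarith [Real.exp_one_lt_d9]
  have hl := Real.log_le_sub_one_of_pos (show 0 < 3 * (1 + s * z) by positivity)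
  rw [Real.log_mul (by norm_num) h1.ne'] at hl
  have key := scaled_log_sub_le hs hs1 hn h1
  calc _ ≤ Real.exp (p * (n * (Real.log (1 + s * z) - s * z)))
        * Real.exp (-((n * p + κ) * (1 + s * z))) := by gcongr; exact kern_le hp hz
    _ ≤ _ := by
      rw [← Real.exp_add, ← Real.exp_add, ← Real.exp_add]
      refine Real.exp_le_exp.mpr ?_
      -- From $\log(3u)\le3u-1$ and $\log3\ge1$ with $u=1+sz$. The resulting slope in $u$ cancels
      -- exactly and leaves $-np/2$.
      have a1 : n * p * (Real.log (1 + s * z) / 2) ≤ n * p * (3 * (1 + s * z) / 2 - 1) := by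
        gcongr
        linarith
      have a2 : 0 ≤ κ * (1 + s * z) := by positivity
      have a3 := mul_le_mul_of_nonneg_left key hp.le
      nlinarith [abs_nonneg z]

theorem norm_integral_kern_mul_le {κ n : ℕ} {c p s C₀ : ℝ} (hp : 0 < p) (hp1 : p ≤ 1) (hs : 0 < s)
    (hs1 : s ≤ 1) (hn : n * s ^ 2 = 1) (hc : c * Real.exp (1 / p) = n * p + κ) {h : ℝ → ℂ}
    (hh : ∀ y, 1 < y → ‖h y‖ ≤ C₀ * Real.exp (-(c * y))) (hC₀ : 0 ≤ C₀) :
    ‖∫ z in kernDomain p s, (kern κ n p s z : ℂ) * h (Real.exp (1 / p) * (1 + s * z))‖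
      ≤ C₀ * (24 * Real.exp 1) * (1 / p) * Real.exp (-(n * p / 2)) := by
  have hm := measurableSet_kernDomain p s
  rw [← integral_indicator hm]
  have hb := (integrable_exp_neg_mul_abs (a := p / 12) (by positivity)).const_mul
    (C₀ * Real.exp (-(n * p / 2)) * Real.exp 1)
  refine (norm_integral_le_of_norm_le hb (.of_forall fun z => ?_)).trans (le_of_eq ?_)
  · by_cases hz : z ∈ kernDomain p s
    · rw [Set.indicator_of_mem hz, norm_mul, Complex.norm_real, Real.norm_eq_abs,
        abs_of_nonneg (kern_nonneg hp hz)]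
      have hy : 1 < Real.exp (1 / p) * (1 + s * z) := by
        rw [← Set.mem_Ioi, ← image_kernDomain (p := p) hs]
        exact ⟨z, hz, rfl⟩
      have h1 := hh _ hy
      rw [← mul_assoc, hc] at h1
      calc _ ≤ kern κ n p s z * (C₀ * Real.exp (-((n * p + κ) * (1 + s * z)))) := by
            gcongr
            exact kern_nonneg hp hz
        _ = C₀ * (kern κ n p s z * Real.exp (-((n * p + κ) * (1 + s * z)))) := by ring
        _ ≤ C₀ * (Real.exp (-(n * p / 2)) * (Real.exp 1 * Real.exp (-(p / 12 * |z|)))) := by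
            exact mul_le_mul_of_nonneg_left (kern_mul_exp_le hp hp1 hs hs1 hn hz) hC₀
        _ = _ := by ring
    · rw [Set.indicator_of_notMem hz, norm_zero]
      positivity
  · rw [integral_const_mul, integral_exp_neg_mul_abs (by positivity)]
    field_simp
    ring

/-- The leading term of the Laplace integral. -/
noncomputable def laplaceLeading (κ n : ℕ) (x : ℝ) : ℝ :=
  (x / 2) ^ n * Real.exp (x / 2) ^ (κ + 1) * Real.exp (-(n * (2 / x) + κ))
    * √(2 * π / (n * (2 / x + (2 / x) ^ 2) + κ))

theorem exp_neg_le_pow (k : ℕ) {Y : ℝ} (hY : 0 < Y) :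
    Real.exp (-Y) ≤ k.factorial * (1 / Y) ^ k := by
  have h := Real.pow_div_factorial_le_exp Y hY.le k
  have hk : (0 : ℝ) < k.factorial := by exact_mod_cast k.factorial_pos
  rw [Real.exp_neg, div_pow, one_pow, mul_one_div, ← inv_div]
  gcongr

theorem exists_integral_expansion (κ : ℕ) : ∃ b : ℕ → RatFunc ℚ, b 1 = firstCorrection ∧
    ∀ (J : ℕ) (C₀ : ℝ), 0 ≤ C₀ → ∃ C : ℝ, 0 ≤ C ∧ ∃ M : ℕ, ∀ (n : ℕ) (x c : ℝ) (g : ℝ → ℂ),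
      1 ≤ n → 2 ≤ x → c * Real.exp (x / 2) = n * (2 / x) + κ → Measurable g →
      (∀ y, 1 < y → ‖g y - 1‖ ≤ C₀ * Real.exp (-(c * y))) →
      ‖(∫ y in Set.Ioi (1 : ℝ), ((Real.log y ^ n * y ^ κ * Real.exp (-(c * y)) : ℝ) : ℂ) * g y)
        - laplaceLeading κ n x
          * ((1 + ∑ j ∈ Finset.Icc 1 J, (b j).eval (algebraMap ℚ ℝ) x / (n : ℝ) ^ j : ℝ) : ℂ)‖
      ≤ laplaceLeading κ n x * (C * (1 / n) ^ (J + 1) * x ^ M) := by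
  obtain ⟨b, hb1, hb⟩ := exists_laplace_expansion κ
  refine ⟨b, hb1, fun J C₀ hC₀ => ?_⟩
  obtain ⟨C, hC, M, h⟩ := hb J
  -- In the exponent $J+3$, the part $J+1$ comes from $e^{-np/2}\le(J+1)!\,(x/n)^{J+1}$, one further
  -- power from `D` and one from the $1/p$ in the bound for `W`.
  refine ⟨C + (1 + κ) * (C₀ * (24 * Real.exp 1) * (J + 1).factorial), by positivity,
    M + (J + 3), fun n x c g hn1 hx hc hg hgb => ?_⟩
  have hn0 : (0 : ℝ) < n := by exact_mod_cast hn1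
  have hx0 : 0 < x := by linarith
  set p := 2 / x with hp
  have hp0 : 0 < p := by positivity
  have hp1 : p ≤ 1 := by rw [hp, div_le_one hx0]; exact hx
  have hxp : x / 2 = 1 / p := by rw [hp, one_div_div]
  set s := 1 / √n with hs
  have hs0 : 0 < s := by positivity
  have hs2 : s ^ 2 = 1 / n := by rw [hs, div_pow, one_pow, Real.sq_sqrt hn0.le]
  have hns : n * s ^ 2 = 1 := by rw [hs2]; field_simp
  have hs1 : s ≤ 1 := by
    rw [hs, div_le_one (by positivity), Real.one_le_sqrt]
    exact_mod_cast hn1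
  rw [hxp] at hc
  set q := p + p ^ 2 with hq
  have hq0 : 0 < q := by positivity
  set D := √(q / (2 * π)) * √(1 + κ / q * s ^ 2) with hD
  have hD0 : 0 ≤ D := by positivity
  set R := √(2 * π / (n * q + κ)) with hR
  have hR0 : 0 ≤ R := Real.sqrt_nonneg _
  -- The Gaussian normalization $\sqrt{q/2\pi}$ and the correction $\sqrt{1+\kappa s^2/q}$ combine
  -- into the exact second derivative $nq+\kappa$ of the leading term.
  have hDR : R * D = s := by
    rw [hD, hR, ← Real.sqrt_mul (by positivity), ← Real.sqrt_mul (by positivity)]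
    rw [show 2 * π / (n * q + κ) * (q / (2 * π) * (1 + κ / q * s ^ 2)) = s ^ 2 by
      have e : n * q + κ ≠ 0 := by positivity
      rw [hs2]
      field_simp]
    exact Real.sqrt_sq hs0.le
  set A₀ := (1 / p) ^ n * Real.exp (1 / p) ^ (κ + 1) * Real.exp (-(n * p + κ)) with hA₀
  have hA₀0 : 0 ≤ A₀ := by positivity
  have hA : laplaceLeading κ n x = A₀ * R := by rw [laplaceLeading, hxp]
  have i1 := (integrableOn_kern (κ := κ) hp0 hp1 hs0 hs1 hns)
  have hyD : ∀ z ∈ kernDomain p s, 1 < Real.exp (1 / p) * (1 + s * z) := fun z hz => by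
    rw [← Set.mem_Ioi, ← image_kernDomain (p := p) hs0]
    exact ⟨z, hz, rfl⟩
  have hc0 : 0 < c := by
    have : 0 < c * Real.exp (1 / p) := by rw [hc]; positivity
    exact pos_of_mul_pos_left this (Real.exp_pos _).le
  have i2 : IntegrableOn (fun z => (kern κ n p s z : ℂ)
      * (g (Real.exp (1 / p) * (1 + s * z)) - 1)) (kernDomain p s) := by
    refine Integrable.mono' (i1.mul_const C₀) (by
      have := measurable_kern κ n p s
      have : Measurable fun z : ℝ => Real.exp (1 / p) * (1 + s * z) := by fun_prop
      have := hg.comp this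
      fun_prop) ?_
    filter_upwards [ae_restrict_mem (measurableSet_kernDomain p s)] with z hz
    rw [norm_mul, Complex.norm_real, Real.norm_eq_abs, abs_of_nonneg (kern_nonneg hp0 hz)]
    have hy := hyD z hz
    have h1 := hgb _ hy
    have h2 : Real.exp (-(c * (Real.exp (1 / p) * (1 + s * z)))) ≤ 1 :=
      Real.exp_le_one_iff.mpr (by nlinarith)
    refine mul_le_mul_of_nonneg_left ?_ (kern_nonneg hp0 hz)
    nlinarith
  have hsplit : ∫ z in kernDomain p s, (kern κ n p s z : ℂ) * g (Real.exp (1 / p) * (1 + s * z))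
      = ((∫ z in kernDomain p s, kern κ n p s z : ℝ) : ℂ) + ∫ z in kernDomain p s,
        (kern κ n p s z : ℂ) * (g (Real.exp (1 / p) * (1 + s * z)) - 1) := by
    have i1' : IntegrableOn (fun z => (kern κ n p s z : ℂ)) (kernDomain p s) := i1.ofReal
    rw [← integral_complex_ofReal, ← integral_add i1' i2]
    congr 1
    funext z
    ring
  have herr := norm_integral_kern_mul_le hp0 hp1 hs0 hs1 hns hc hgb hC₀
  set Q := ∫ z in kernDomain p s, kern κ n p s z with hQ
  set W := ∫ z in kernDomain p s,
        (kern κ n p s z : ℂ) * (g (Real.exp (1 / p) * (1 + s * z)) - 1) with hW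
  have hmain := h n x s hx hs0 hs1 hns
  rw [← mul_assoc] at hmain
  set P := 1 + ∑ j ∈ Finset.Icc 1 J, (b j).eval (algebraMap ℚ ℝ) x / (n : ℝ) ^ j with hP
  have hDle : D ≤ (1 + κ) * (1 / p) := by
    have h1 := sqrt_factor_le κ hp0 hp1 hs0 hs1
    have h2 : √(q / (2 * π)) ≤ 1 := by
      refine Real.sqrt_le_one.mpr ?_
      rw [div_le_one (by positivity)]
      nlinarith [Real.pi_gt_three]
    calc D ≤ 1 * ((1 + κ) * (1 / p)) := by rw [hD]; gcongr
      _ = _ := one_mul _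
  have hexp : Real.exp (-(n * p / 2)) ≤ (J + 1).factorial * (1 / n) ^ (J + 1) * x ^ (J + 1) := by
    have := exp_neg_le_pow (J + 1) (show 0 < n * p / 2 by positivity)
    have e : 1 / (n * p / 2) = 1 / n * x := by rw [hp]; field_simp
    rw [e, mul_pow, ← mul_assoc] at this
    exact this
  have hpx : 1 / p ≤ x := by rw [← hxp]; linarith
  have hx1 : 1 ≤ x := by linarith
  have hfin : D * ‖W‖ ≤ (1 + κ) * (C₀ * (24 * Real.exp 1) * (J + 1).factorial)
      * (1 / n) ^ (J + 1) * x ^ (M + (J + 3)) := by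
    calc D * ‖W‖ ≤ ((1 + κ) * x) * (C₀ * (24 * Real.exp 1) * x
          * ((J + 1).factorial * (1 / n) ^ (J + 1) * x ^ (J + 1))) := by
          have h1 : D ≤ (1 + κ) * x := hDle.trans (by gcongr)
          have h2 : ‖W‖ ≤ C₀ * (24 * Real.exp 1) * x
              * ((J + 1).factorial * (1 / n) ^ (J + 1) * x ^ (J + 1)) :=
            herr.trans (by gcongr)
          exact mul_le_mul h1 h2 (norm_nonneg _) (by positivity)
      _ = ((1 + κ) * (C₀ * (24 * Real.exp 1) * (J + 1).factorial)
          * (1 / n) ^ (J + 1)) * x ^ (J + 3) := by ring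
      _ ≤ _ := by
          refine mul_le_mul_of_nonneg_left ?_ (by positivity)
          exact pow_le_pow_right₀ hx1 (by lia)
  have hmain2 : |D * Q - P| ≤ C * (1 / n) ^ (J + 1) * x ^ (M + (J + 3)) := by
    refine hmain.trans ?_
    rw [pow_mul, hs2]
    refine mul_le_mul_of_nonneg_left ?_ (by positivity)
    exact pow_le_pow_right₀ hx1 (by lia)
  rw [integral_eq_integral_kern κ n hp0 hs0 hc g, hsplit, hA, ← hA₀, ← hDR]
  have e : ((A₀ * (R * D) : ℝ) : ℂ) * (Q + W) - ((A₀ * R : ℝ) : ℂ) * (P : ℂ)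
      = ((A₀ * R : ℝ) : ℂ) * (((D * Q - P : ℝ) : ℂ) + D * W) := by
    push_cast
    ring
  rw [e, norm_mul, Complex.norm_real, Real.norm_eq_abs, abs_of_nonneg (by positivity)]
  refine mul_le_mul_of_nonneg_left ?_ (by positivity)
  refine (norm_add_le _ _).trans ?_
  rw [Complex.norm_real, Real.norm_eq_abs, norm_mul, Complex.norm_real, Real.norm_eq_abs,
    abs_of_nonneg hD0]
  calc _ ≤ _ := add_le_add hmain2 hfin
    _ = _ := by ring

/-! ### Derivatives of Mellin transforms -/

/-- Functions on `(0, ∞)` that decay faster than any power at both ends. -/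
structure RapidDecay (φ : ℝ → ℂ) : Prop where
  cont : ContinuousOn φ (Set.Ioi 0)
  top : ∀ a : ℝ, φ =O[atTop] fun x => x ^ (-a)
  zero : ∀ b : ℝ, φ =O[𝓝[>] 0] fun x => x ^ (-b)

theorem RapidDecay.log_mul {φ : ℝ → ℂ} (h : RapidDecay φ) :
    RapidDecay fun t => Real.log t • φ t where
  cont := by
    refine ContinuousOn.smul (Real.continuousOn_log.mono fun x hx => ?_) h.cont
    exact (Set.mem_Ioi.mp hx).ne'
  top a := isBigO_rpow_top_log_smul (lt_add_one a) (h.top (a + 1))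
  zero b := isBigO_rpow_zero_log_smul (sub_one_lt b) (h.zero (b - 1))

theorem RapidDecay.mellin_hasDerivAt {φ : ℝ → ℂ} (h : RapidDecay φ) (s : ℂ) :
    MellinConvergent (fun t => Real.log t • φ t) s ∧
      HasDerivAt (mellin φ) (mellin (fun t => Real.log t • φ t) s) s :=
  mellin_hasDerivAt_of_isBigO_rpow (h.cont.locallyIntegrableOn measurableSet_Ioi)
    (h.top (s.re + 1)) (by linarith) (h.zero (s.re - 1)) (by linarith)

theorem RapidDecay.mellinConvergent {φ : ℝ → ℂ} (h : RapidDecay φ) (s : ℂ) :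
    MellinConvergent φ s :=
  mellinConvergent_of_isBigO_rpow (h.cont.locallyIntegrableOn measurableSet_Ioi)
    (h.top (s.re + 1)) (by linarith) (h.zero (s.re - 1)) (by linarith)

/-- Each differentiation multiplies by $\log t$, which preserves rapid decay. -/
theorem RapidDecay.iteratedDeriv_mellin {φ : ℝ → ℂ} (h : RapidDecay φ) (n : ℕ) :
    RapidDecay (fun t => (Real.log t ^ n : ℝ) • φ t) ∧
      iteratedDeriv n (mellin φ) = mellin fun t => (Real.log t ^ n : ℝ) • φ t := by
  induction n generalizing φ with
  | zero => simpa using h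
  | succ n ih =>
    have e : (fun t => (Real.log t ^ (n + 1) : ℝ) • φ t)
        = fun t => (Real.log t ^ n : ℝ) • (Real.log t • φ t) := by
      funext t
      rw [smul_smul, pow_succ]
    rw [iteratedDeriv_succ', e, show deriv (mellin φ) = mellin fun t => Real.log t • φ t from
      funext fun s => (h.mellin_hasDerivAt s).2.deriv]
    exact ih h.log_mul

/-! ### Folding the Mellin integral at the fixed point of the functional equation -/

theorem image_inv_Ioi_one : (fun t : ℝ => t⁻¹) '' Set.Ioi 1 = Set.Ioo 0 1 := by
  ext y
  constructor
  · rintro ⟨t, ht, rfl⟩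
    have ht' : (1 : ℝ) < t := ht
    exact ⟨inv_pos.mpr (by linarith), inv_lt_one_of_one_lt₀ ht'⟩
  · rintro ⟨h0, h1⟩
    exact ⟨y⁻¹, (one_lt_inv₀ h0).mpr h1, inv_inv y⟩

theorem integral_Ioo_eq_integral_Ioi (F : ℝ → ℂ) :
    ∫ t in Set.Ioo (0 : ℝ) 1, F t = ∫ t in Set.Ioi (1 : ℝ), ((t ^ 2)⁻¹ : ℝ) • F t⁻¹ := by
  rw [← image_inv_Ioi_one, integral_image_eq_integral_abs_deriv_smul
    (f' := fun t => -(t ^ 2)⁻¹) measurableSet_Ioi]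
  · refine setIntegral_congr_fun measurableSet_Ioi fun t _ => ?_
    simp only [abs_neg]
    rw [abs_of_nonneg (by positivity)]
  · intro t ht
    have : (0 : ℝ) < t := one_pos.trans ht
    exact (hasDerivAt_inv this.ne').hasDerivWithinAt
  · intro a _ b _ h
    exact inv_injective h

/-- Under $t\mapsto1/t$ the logarithm contributes $(-1)^n$, and the powers recombine as
$t^{-\kappa}\cdot t^{-2}\cdot t^{2\kappa+2}=t^\kappa$, so the part over $(0,1)$ is a multiple of the
part over $(1,\infty)$. -/
theorem mellin_log_fold {φ : ℝ → ℂ} (h : RapidDecay φ) {η : ℂ} (κ n : ℕ)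
    (hfe : ∀ t : ℝ, 0 < t → φ t⁻¹ = η * (t : ℂ) ^ (2 * (κ + 1)) * φ t) :
    mellin (fun t => (Real.log t ^ n : ℝ) • φ t) (κ + 1)
      = (1 + (-1) ^ n * η) * ∫ t in Set.Ioi (1 : ℝ), ((Real.log t ^ n * t ^ κ : ℝ) : ℂ) * φ t := by
  set F : ℝ → ℂ := fun t => ((Real.log t ^ n * t ^ κ : ℝ) : ℂ) * φ t with hF
  have hcong : ∀ t : ℝ, (t : ℂ) ^ ((κ + 1 : ℂ) - 1) • ((Real.log t ^ n : ℝ) • φ t) = F t := by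
    intro t
    rw [add_sub_cancel_right, Complex.cpow_natCast, hF, Complex.real_smul, smul_eq_mul]
    push_cast
    ring
  have hint : IntegrableOn F (Set.Ioi 0) := by
    have := (h.iteratedDeriv_mellin n).1.mellinConvergent (κ + 1)
    rw [MellinConvergent] at this
    simpa only [hcong] using this
  have hsplit : Set.Ioi (0 : ℝ) = Set.Ioc 0 1 ∪ Set.Ioi 1 :=
    (Set.Ioc_union_Ioi_eq_Ioi zero_le_one).symm
  rw [mellin]
  simp only [hcong]
  rw [hsplit, setIntegral_union (Set.Ioc_disjoint_Ioi le_rfl) measurableSet_Ioi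
    (hint.mono_set Set.Ioc_subset_Ioi_self) (hint.mono_set (Set.Ioi_subset_Ioi zero_le_one)),
    integral_Ioc_eq_integral_Ioo, integral_Ioo_eq_integral_Ioi, add_mul, one_mul, add_comm,
    ← integral_const_mul]
  congr 1
  refine setIntegral_congr_fun measurableSet_Ioi fun t ht => ?_
  have ht0 : (0 : ℝ) < t := one_pos.trans ht
  have htc : (t : ℂ) ≠ 0 := by exact_mod_cast ht0.ne'
  simp only [hF]
  rw [hfe t ht0, Real.log_inv, Complex.real_smul]
  push_cast
  rw [neg_pow, inv_pow]
  field_simp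
  ring

/-! ### The modular form on the imaginary axis -/

/-- The restriction `t ↦ f(i t / √N)` of `f` to the imaginary axis. -/
noncomputable def axis {N : ℕ} {k : ℤ} (f : CuspFormGamma0 N k) (t : ℝ) : ℂ :=
  f (ofComplex (I * (((√(N : ℝ))⁻¹ * t : ℝ) : ℂ)))

theorem qCoeff_zero {N : ℕ} {k : ℤ} (f : CuspFormGamma0 N k) : qCoeff f 0 = 0 := by
  have h1 : (1 : ℝ) ∈ (Gamma0 N : Subgroup (GL (Fin 2) ℝ)).strictPeriods := by
    have := (Gamma0 N : Subgroup (GL (Fin 2) ℝ)).strictWidthInfty_mem_strictPeriods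
    rwa [strictWidthInfty_Gamma0 N] at this
  exact CuspFormClass.qExpansion_coeff_zero f one_pos h1

section ImaginaryAxis

variable {N : ℕ} [NeZero N] {k : ℤ}

theorem sqrt_level_pos : 0 < √(N : ℝ) := Real.sqrt_pos.mpr (by
  exact_mod_cast Nat.pos_of_ne_zero (NeZero.ne N))

theorem completedL_eq_mellin (hk : 0 < k) (f : CuspFormGamma0 N k) :
    completedL hk f = mellin (axis f) := by
  funext s
  have hN : (0 : ℝ) < N := by exact_mod_cast Nat.pos_of_ne_zero (NeZero.ne N)
  have ha : 0 < (√(N : ℝ))⁻¹ := inv_pos.mpr sqrt_level_pos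
  have h := mellin_comp_mul_left (fun t : ℝ => f (ofComplex (I * t))) s ha
  rw [completedL, CuspForm.Λ_eq_mellin]
  refine Eq.trans ?_ h.symm
  rw [smul_eq_mul]
  congr 1
  rw [Complex.cpow_def_of_ne_zero (NeZero.ne _), Complex.cpow_def_of_ne_zero (by
    exact_mod_cast ha.ne'), ← Complex.ofReal_log ha.le, Real.log_inv, Real.log_sqrt hN.le,
    ← Complex.natCast_log]
  push_cast
  ring_nf

theorem axis_point {t : ℝ} (ht : 0 < t) :
    0 < (I * (((√(N : ℝ))⁻¹ * t : ℝ) : ℂ)).im := by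
  have : 0 < (√(N : ℝ))⁻¹ * t := mul_pos (inv_pos.mpr sqrt_level_pos) ht
  rwa [Complex.mul_im, Complex.I_re, Complex.I_im, Complex.ofReal_im, Complex.ofReal_re, mul_zero, one_mul,
    zero_add]

/-- The Fricke involution sends $it/\sqrt N$ to $i/(t\sqrt N)$, and the powers of $N$ cancel. -/
theorem axis_inv (f : CuspFormGamma0 N k) {ε : ℂ}
    (hε : ∀ τ : ℍ, atkinLehner N k f τ = ε * f τ) {t : ℝ} (ht : 0 < t) :
    axis f t⁻¹ = ε * I ^ k * (t : ℂ) ^ k * axis f t := by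
  have hN : (0 : ℝ) < N := by exact_mod_cast Nat.pos_of_ne_zero (NeZero.ne N)
  have hs := sqrt_level_pos (N := N)
  have hsc : ((√(N : ℝ) : ℝ) : ℂ) ≠ 0 := by exact_mod_cast hs.ne'
  have htc : (t : ℂ) ≠ 0 := by exact_mod_cast ht.ne'
  have hsq : ((√(N : ℝ) : ℝ) : ℂ) * (√(N : ℝ) : ℝ) = N := by
    rw [← Complex.ofReal_mul, Real.mul_self_sqrt hN.le, Complex.ofReal_natCast]
  have h := hε (ofComplex (I * (((√(N : ℝ))⁻¹ * t : ℝ) : ℂ)))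
  rw [atkinLehner, ofComplex_apply_of_im_pos (axis_point ht)] at h
  have e1 : (-1 / (N * (I * (((√(N : ℝ))⁻¹ * t : ℝ) : ℂ))) : ℂ)
      = I * (((√(N : ℝ))⁻¹ * t⁻¹ : ℝ) : ℂ) := by
    rw [← hsq]
    push_cast
    field_simp
    rw [I_sq]
  have e2 : (((N : ℝ) ^ (-(k : ℝ) / 2) : ℝ) : ℂ) = ((√(N : ℝ) : ℝ) : ℂ) ^ (-k) := by
    rw [← Complex.ofReal_zpow]
    congr 1
    rw [Real.sqrt_eq_rpow, ← Real.rpow_intCast, ← Real.rpow_mul hN.le]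
    congr 1
    push_cast
    ring
  have h' : ((√(N : ℝ) : ℝ) : ℂ) ^ (-k) * (I * (((√(N : ℝ))⁻¹ * t : ℝ) : ℂ)) ^ (-k) * axis f t⁻¹
      = ε * axis f t := by
    rw [axis, axis, ← e1, ← e2, ofComplex_apply_of_im_pos (axis_point ht)]
    exact h
  have e3 : ((√(N : ℝ) : ℝ) : ℂ) ^ (-k) * (I * (((√(N : ℝ))⁻¹ * t : ℝ) : ℂ)) ^ (-k)
      = (I ^ k * (t : ℂ) ^ k)⁻¹ := by
    rw [← mul_zpow, zpow_neg, ← mul_zpow]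
    congr 2
    push_cast
    field_simp
  have h0 : I ^ k * (t : ℂ) ^ k ≠ 0 := mul_ne_zero (zpow_ne_zero _ I_ne_zero) (zpow_ne_zero _ htc)
  rw [e3, inv_mul_eq_iff_eq_mul₀ h0] at h'
  rw [h']
  ring

theorem hasSum_axis (f : CuspFormGamma0 N k) {t : ℝ} (ht : 0 < t) :
    HasSum (fun m : ℕ => qCoeff f m * (Real.exp (-(2 * π / √(N : ℝ) * t)) : ℂ) ^ m) (axis f t) := by
  have h1 : (1 : ℝ) ∈ (Gamma0 N : Subgroup (GL (Fin 2) ℝ)).strictPeriods := by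
    have := (Gamma0 N : Subgroup (GL (Fin 2) ℝ)).strictWidthInfty_mem_strictPeriods
    rwa [strictWidthInfty_Gamma0 N] at this
  have h := ModularForm.hasSum_qExpansion f one_pos h1
    (ofComplex (I * (((√(N : ℝ))⁻¹ * t : ℝ) : ℂ)))
  have e : ((Real.exp (-(2 * π / √(N : ℝ) * t)) : ℝ) : ℂ)
      = Function.Periodic.qParam 1 (ofComplex (I * (((√(N : ℝ))⁻¹ * t : ℝ) : ℂ))) := by
    rw [Function.Periodic.qParam, ofComplex_apply_of_im_pos (axis_point ht), Complex.ofReal_exp]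
    congr 1
    push_cast
    field_simp
    rw [I_sq]
    ring
  rw [axis, e]
  exact h

/-- On the axis $f$ is a power series in $x=e^{-ct}$ starting with $x$. After division by $x$ and
subtraction of $1$ the tail is $x$ times a series dominated by its value at $t=1$. -/
theorem axis_sub_exp_le (f : CuspFormGamma0 N k) (hf : qCoeff f 1 = 1) : ∃ C : ℝ, 0 ≤ C ∧
    ∀ t : ℝ, 1 ≤ t → ‖axis f t * Real.exp (2 * π / √(N : ℝ) * t) - 1‖
      ≤ C * Real.exp (-(2 * π / √(N : ℝ) * t)) := by
  set c := 2 * π / √(N : ℝ) with hc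
  have hc0 : 0 < c := div_pos (by positivity) sqrt_level_pos
  set r := Real.exp (-(c * 1)) with hr
  have hr0 : 0 < r := Real.exp_pos _
  have hs1 : Summable fun m : ℕ => ‖qCoeff f m‖ * r ^ m := by
    have := (hasSum_axis f one_pos).summable.norm
    refine this.congr fun m => ?_
    rw [norm_mul, norm_pow, Complex.norm_real, Real.norm_eq_abs, abs_of_pos (Real.exp_pos _)]
  have hs2 : Summable fun m : ℕ => ‖qCoeff f (m + 2)‖ * r ^ m := by
    have := ((summable_nat_add_iff 2).mpr hs1).mul_right (r ^ 2)⁻¹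
    refine this.congr fun m => ?_
    rw [pow_add]
    field_simp
  refine ⟨∑' m : ℕ, ‖qCoeff f (m + 2)‖ * r ^ m, tsum_nonneg fun m => by positivity,
    fun t ht => ?_⟩
  set x := Real.exp (-(c * t)) with hx
  have hx0 : 0 < x := Real.exp_pos _
  have hxr : x ≤ r := by rw [hx, hr]; gcongr
  have hE : Real.exp (c * t) = x⁻¹ := by rw [hx, ← Real.exp_neg, neg_neg]
  have h := (hasSum_nat_add_iff' 2).mpr (hasSum_axis f (zero_lt_one.trans_le ht))
  rw [← hc, ← hx] at h
  simp only [Finset.sum_range_succ, Finset.sum_range_zero, qCoeff_zero, hf, zero_mul, zero_add,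
    one_mul, pow_one] at h
  have hxc : (x : ℂ) ≠ 0 := by exact_mod_cast hx0.ne'
  have e : axis f t * (Real.exp (c * t) : ℂ) - 1 = (x : ℂ)⁻¹ * (axis f t - x) := by
    rw [hE]
    push_cast
    field_simp
  rw [e, ← h.tsum_eq, ← tsum_mul_left, mul_comm, ← tsum_mul_left]
  refine tsum_of_norm_bounded (hs2.mul_left x).hasSum fun m => ?_
  rw [norm_mul, norm_mul, norm_inv, norm_pow, Complex.norm_real, Real.norm_eq_abs, abs_of_pos hx0]
  calc _ = x * (‖qCoeff f (m + 2)‖ * x ^ m) := by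
        rw [pow_add]
        field_simp
    _ ≤ _ := by gcongr

theorem continuousOn_axis (f : CuspFormGamma0 N k) : ContinuousOn (axis f) (Set.Ioi 0) := by
  have h : ContinuousOn (fun t : ℝ => f (ofComplex (I * t))) (Set.Ioi 0) := by fun_prop
  refine h.comp (f := fun t : ℝ => (√(N : ℝ))⁻¹ * t) (by fun_prop) fun t ht => ?_
  exact mul_pos (inv_pos.mpr sqrt_level_pos) ht

theorem axis_top (f : CuspFormGamma0 N k) (hf : qCoeff f 1 = 1) (a : ℝ) :
    axis f =O[atTop] fun x => x ^ (-a) := by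
  obtain ⟨C, hC, h⟩ := axis_sub_exp_le f hf
  set c := 2 * π / √(N : ℝ) with hc
  have hc0 : 0 < c := div_pos (by positivity) sqrt_level_pos
  refine IsBigO.trans ?_ (isLittleO_exp_neg_mul_rpow_atTop hc0 (-a)).isBigO
  refine IsBigO.of_bound (C + 1) ?_
  filter_upwards [eventually_ge_atTop 1] with t ht
  have h1 := h t ht
  have h2 : Real.exp (-(c * t)) ≤ 1 := Real.exp_le_one_iff.mpr (by nlinarith)
  have h3 : ‖axis f t * Real.exp (c * t)‖ ≤ C + 1 := by
    have := norm_add_le (axis f t * Real.exp (c * t) - 1) 1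
    rw [sub_add_cancel, norm_one] at this
    nlinarith
  rw [norm_mul, Complex.norm_real, Real.norm_eq_abs, abs_of_pos (Real.exp_pos _)] at h3
  rw [Real.norm_eq_abs, abs_of_pos (Real.exp_pos _), neg_mul, Real.exp_neg, ← div_eq_mul_inv,
    le_div_iff₀ (Real.exp_pos _)]
  exact h3

/-- Decay at $0$ is transported from infinity by the functional equation. -/
theorem rapidDecay_axis (f : CuspFormGamma0 N k) (hf : qCoeff f 1 = 1) {ε : ℂ}
    (hε : ∀ τ : ℍ, atkinLehner N k f τ = ε * f τ) : RapidDecay (axis f) where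
  cont := continuousOn_axis f
  top := axis_top f hf
  zero b := by
    have h := ((axis_top f hf (k - b)).comp_tendsto tendsto_inv_nhdsGT_zero)
    have h2 : axis f =O[𝓝[>] 0] fun t : ℝ => t ^ (-k) • (axis f t⁻¹) := by
      refine IsBigO.of_bound ‖ε * I ^ k‖ ?_
      filter_upwards [self_mem_nhdsWithin] with t ht
      have ht0 : (0 : ℝ) < t := ht
      have := axis_inv f hε (inv_pos.mpr ht0)
      rw [inv_inv] at this
      rw [this, norm_mul, norm_mul, norm_smul, mul_assoc]
      gcongr
      rw [← Complex.ofReal_zpow, Complex.norm_real, inv_zpow, zpow_neg]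
    refine h2.trans ?_
    refine ((isBigO_refl (fun t : ℝ => t ^ (-k)) (𝓝[>] 0)).smul h).trans ?_
    refine EventuallyEq.isBigO ?_
    filter_upwards [self_mem_nhdsWithin] with t ht
    have ht0 : (0 : ℝ) < t := ht
    simp only [Function.comp_apply, smul_eq_mul]
    rw [Real.inv_rpow ht0.le, ← Real.rpow_neg ht0.le, ← Real.rpow_intCast, ← Real.rpow_add ht0]
    congr 1
    push_cast
    ring

theorem I_zpow_mul_self (hke : Even k) : I ^ k * I ^ k = 1 := by
  obtain ⟨j, rfl⟩ := hke
  rw [← zpow_add₀ I_ne_zero, show j + j + (j + j) = 4 * j by ring, zpow_mul]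
  have : I ^ (4 : ℤ) = 1 := by exact_mod_cast I_pow_four
  rw [this, one_zpow]

/-- Applying the functional equation twice gives $\varphi=\epsilon^2\varphi$ on the axis, since
$(i^k)^2=1$ for even $k$; and $\varphi(t)\ne0$ for large $t$ because $\varphi(t)e^{ct}\to1$. -/
theorem eigenvalue_eq (hke : Even k) (f : CuspFormGamma0 N k) (hf : qCoeff f 1 = 1) {ε : ℂ}
    (hε : ∀ τ : ℍ, atkinLehner N k f τ = ε * f τ) : ε = 1 ∨ ε = -1 := by
  obtain ⟨C, hC, h⟩ := axis_sub_exp_le f hf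
  set c := 2 * π / √(N : ℝ) with hc
  have hc0 : 0 < c := div_pos (by positivity) sqrt_level_pos
  obtain ⟨t, ht1, ht⟩ : ∃ t : ℝ, 1 ≤ t ∧ axis f t ≠ 0 := by
    have hlim : Tendsto (fun t : ℝ => C * Real.exp (-(c * t))) atTop (𝓝 (C * 0)) :=
      (Real.tendsto_exp_neg_atTop_nhds_zero.comp (tendsto_id.const_mul_atTop hc0)).const_mul C
    rw [mul_zero] at hlim
    obtain ⟨t, h1, h2⟩ := ((hlim.eventually_lt_const one_pos).and (eventually_ge_atTop 1)).exists
    refine ⟨t, h2, fun h0 => ?_⟩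
    have := h t h2
    rw [h0, zero_mul, zero_sub, norm_neg, norm_one] at this
    linarith
  have ht0 : 0 < t := by linarith
  have htc : (t : ℂ) ≠ 0 := by exact_mod_cast ht0.ne'
  have h1 := axis_inv f hε ht0
  have h2 := axis_inv f hε (inv_pos.mpr ht0)
  rw [inv_inv, h1] at h2
  have h3 : ((t⁻¹ : ℝ) : ℂ) ^ k * (t : ℂ) ^ k = 1 := by
    rw [← mul_zpow, Complex.ofReal_inv, inv_mul_cancel₀ htc, one_zpow]
  have h4 : axis f t = ε ^ 2 * axis f t := by
    linear_combination h2 + ε ^ 2 * axis f t * I ^ k * I ^ k * h3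
      + ε ^ 2 * axis f t * I_zpow_mul_self hke
  have h5 : ε ^ 2 = 1 := (mul_right_cancel₀ ht ((one_mul _).trans h4)).symm
  exact mul_self_eq_one_iff.mp (by rw [← sq]; exact h5)

end ImaginaryAxis

/-! ### The saddle point -/

theorem saddleFun_eq {N : ℕ} [NeZero N] (κ : ℕ) (x : ℝ) :
    saddleFun N (2 * ((κ : ℤ) + 1)) x
      = 1 / 2 * (2 * π / √(N : ℝ) * Real.exp (x / 2) - κ) * x := by
  have hN : (0 : ℝ) < N := by exact_mod_cast Nat.pos_of_ne_zero (NeZero.ne N)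
  have e : Real.exp ((x - Real.log N) / 2) = Real.exp (x / 2) / √(N : ℝ) := by
    rw [sub_div, Real.exp_sub, ← Real.log_sqrt hN.le, Real.exp_log (Real.sqrt_pos.mpr hN)]
  rw [saddleFun, e]
  push_cast
  ring

/-- The function need not be increasing everywhere, since its first factor may start negative. From
any point where the value is $n>0$ onwards both factors are positive and increasing, which gives
uniqueness; existence is the intermediate value theorem. -/
theorem exists_saddle {c : ℝ} (hc : 0 < c) (κ : ℕ) {n : ℕ} (hn : 1 ≤ n) : ∃ x : ℝ, 0 < x ∧
    1 / 2 * (c * Real.exp (x / 2) - κ) * x = n ∧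
    ∀ y : ℝ, 0 < y → 1 / 2 * (c * Real.exp (y / 2) - κ) * y = n → y = x := by
  have hn0 : (0 : ℝ) < n := by exact_mod_cast hn
  set F : ℝ → ℝ := fun x => 1 / 2 * (c * Real.exp (x / 2) - κ) * x with hF
  have hmono : ∀ x y : ℝ, 0 < x → x < y → F x = n → F y ≠ n := by
    intro x y hx hxy h h'
    have hA : 0 < 1 / 2 * (c * Real.exp (x / 2) - κ) := by
      refine pos_of_mul_pos_left ?_ hx.le
      exact hn0.trans_eq h.symm
    have hlt : 1 / 2 * (c * Real.exp (x / 2) - κ) < 1 / 2 * (c * Real.exp (y / 2) - κ) := by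
      gcongr
    have := mul_lt_mul'' hlt hxy hA.le hx.le
    exact this.ne (h.trans h'.symm)
  have htop : Tendsto F atTop atTop := by
    have h1 : Tendsto (fun x : ℝ => c * Real.exp (x / 2)) atTop atTop :=
      (Real.tendsto_exp_atTop.comp (tendsto_id.atTop_div_const two_pos)).const_mul_atTop hc
    have h2 := (tendsto_atTop_add_const_right atTop (-(κ : ℝ)) h1).const_mul_atTop
      (one_half_pos (α := ℝ))
    exact h2.atTop_mul_atTop₀ tendsto_id
  obtain ⟨B, hB, hB0⟩ := ((htop.eventually_ge_atTop (n : ℝ)).and (eventually_ge_atTop 0)).exists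
  obtain ⟨x, hx, hxn⟩ := intermediate_value_Icc hB0
    (f := F) (by fun_prop) (show (n : ℝ) ∈ Set.Icc (F 0) (F B) from ⟨by simp [hF], hB⟩)
  have hx0 : 0 < x := by
    refine lt_of_le_of_ne hx.1 fun h0 => ?_
    rw [← h0] at hxn
    simp only [hF, mul_zero] at hxn
    exact hn0.ne hxn
  refine ⟨x, hx0, hxn, fun y hy hyn => ?_⟩
  rcases lt_trichotomy y x with h | h | h
  · exact absurd hxn (hmono y x hy h hyn)
  · exact h
  · exact absurd hyn (hmono x y hx0 h hxn)

/-- If $L(n)$ stayed below $B$, the equation would bound $n$ by a constant depending on $B$. -/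
theorem tendsto_saddle {c : ℝ} (hc : 0 < c) (κ : ℕ) {L : ℕ → ℝ} (hL0 : ∀ n, 1 ≤ n → 0 < L n)
    (hL : ∀ n : ℕ, 1 ≤ n → 1 / 2 * (c * Real.exp (L n / 2) - κ) * L n = n) :
    Tendsto L atTop atTop := by
  refine tendsto_atTop.mpr fun B => ?_
  filter_upwards [eventually_ge_atTop 1,
    (tendsto_natCast_atTop_atTop (R := ℝ)).eventually_gt_atTop
      (1 / 2 * (c * Real.exp (B / 2)) * B)] with n hn hB
  by_contra! h
  have h0 := hL0 n hn
  have h1 : 1 / 2 * (c * Real.exp (L n / 2) - κ) * L n ≤ 1 / 2 * (c * Real.exp (B / 2)) * B := by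
    have hκ : (0 : ℝ) ≤ κ := Nat.cast_nonneg κ
    calc _ ≤ 1 / 2 * (c * Real.exp (L n / 2)) * L n := by gcongr; linarith
      _ ≤ _ := by gcongr
  rw [hL n hn] at h1
  linarith

/-- The two-sided bound on `n` implied by the saddle point equation when the saddle point is large
enough. -/
theorem saddle_bounds {a x : ℝ} {κ n : ℕ} (ha : 0 < a) (hx : 2 ≤ x)
    (h : 1 / 2 * (2 * π / a * Real.exp (x / 2) - κ) * x = n) (hκ : κ * a ≤ π * Real.exp (x / 2)) :
    π * Real.exp (x / 2) * (x / 2) ≤ n * a ∧ n * a ≤ 2 * π * Real.exp (x / 2) * (x / 2) := by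
  have e : n * a = (2 * π * Real.exp (x / 2) - κ * a) * (x / 2) := by
    rw [← h]
    field_simp
  have hk : 0 ≤ κ * a := by positivity
  rw [e]
  constructor
  · gcongr
    linarith
  · gcongr
    linarith

/-- Here $l=L/2$ and $X=n\sqrt N$. Taking logarithms, $\log X=l+\log l+O(1)$ and $\log\log X=\log
l+O(1)$, so the terms $\log l$ cancel in $\log(X/\log X)$. -/
theorem abs_saddle_sub_log_le {X l : ℝ} (hl : 1 ≤ l) (h1 : π * Real.exp l * l ≤ X)
    (h2 : X ≤ 2 * π * Real.exp l * l) :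
    |2 * l - 2 * Real.log (X / Real.log X)| ≤ 4 := by
  have hl0 : 0 < l := by linarith
  have hX : 0 < X := lt_of_lt_of_le (by positivity) h1
  have hpi1 : 1 ≤ Real.log π := by
    rw [Real.le_log_iff_exp_le Real.pi_pos]
    linarith [Real.exp_one_lt_d9, Real.pi_gt_three]
  have hpi2 : Real.log (2 * π) ≤ 2 := by
    rw [Real.log_le_iff_le_exp (by positivity), show (2 : ℝ) = 1 + 1 by norm_num, Real.exp_add]
    nlinarith [Real.exp_one_gt_d9, Real.pi_lt_d2]
  have hl1 : Real.log l ≤ l - 1 := Real.log_le_sub_one_of_pos hl0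
  have hl2 : 0 ≤ Real.log l := Real.log_nonneg hl
  have a1 : Real.log π + l + Real.log l ≤ Real.log X := by
    have := Real.log_le_log (by positivity) h1
    rwa [Real.log_mul (by positivity) hl0.ne', Real.log_mul Real.pi_ne_zero (Real.exp_ne_zero _),
      Real.log_exp] at this
  have a2 : Real.log X ≤ Real.log (2 * π) + l + Real.log l := by
    have := Real.log_le_log hX h2
    rwa [Real.log_mul (by positivity) hl0.ne', Real.log_mul (by positivity) (Real.exp_ne_zero _),
      Real.log_exp] at this
  have hY : 0 < Real.log X := by linarith
  have b1 : Real.log l ≤ Real.log (Real.log X) := Real.log_le_log hl0 (by linarith)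
  have b2 : Real.log (Real.log X) ≤ 2 + Real.log l := by
    have h4 : Real.log 4 ≤ 2 := by
      rw [Real.log_le_iff_le_exp (by norm_num), show (2 : ℝ) = 1 + 1 by norm_num, Real.exp_add]
      nlinarith [Real.exp_one_gt_d9]
    have := Real.log_le_log hY (show Real.log X ≤ 4 * l by linarith)
    rw [Real.log_mul (by norm_num) hl0.ne'] at this
    linarith
  rw [Real.log_div hX.ne' hY.ne', abs_le]
  constructor <;> linarith

/-- Since $x\le2\log X$, powers of $x$ cost less than any power of $X$; this is where the $\delta$
of the expansion is spent. -/
theorem saddle_pow_le {X x δ : ℝ} (hδ : 0 < δ) (hx : 2 ≤ x) (h : Real.exp (x / 2) ≤ X) (M : ℕ) :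
    x ^ M ≤ (2 / δ) ^ M * M.factorial * X ^ δ := by
  have h1 := Real.pow_div_factorial_le_exp (δ * (x / 2)) (by positivity) M
  have h2 : Real.exp (δ * (x / 2)) ≤ X ^ δ := by
    rw [mul_comm, Real.exp_mul]
    exact Real.rpow_le_rpow (Real.exp_pos _).le h hδ.le
  rw [div_le_iff₀ (by positivity)] at h1
  calc x ^ M = (2 / δ) ^ M * (δ * (x / 2)) ^ M := by
        rw [← mul_pow]
        congr 1
        field_simp
    _ ≤ (2 / δ) ^ M * (X ^ δ * M.factorial) := by
        gcongr
        exact h1.trans (by gcongr)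
    _ = _ := by ring

/-- Uses $(x/2)^2(nq+\kappa)=(1+x/2)n+\kappa x^2/4$ under the root, while $N^{k/4}$ cancels against
$e^{-\frac k4\log N}$. -/
theorem leadingTerm_eq {N : ℕ} [NeZero N] (κ : ℕ) (ε : ℂ) {n : ℕ} (hn : 1 ≤ n) {x : ℝ}
    (hx : 0 < x) :
    leadingTerm N (2 * ((κ : ℤ) + 1)) ε n x
      = laplaceLeading κ n x * (1 + (-1) ^ n * (ε * I ^ (2 * ((κ : ℤ) + 1)))) := by
  have hN : (0 : ℝ) < N := by exact_mod_cast Nat.pos_of_ne_zero (NeZero.ne N)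
  have hn0 : (0 : ℝ) < n := by exact_mod_cast hn
  rw [leadingTerm]
  have e0 : (1 + (-1) ^ n * I ^ (2 * ((κ : ℤ) + 1)) * ε : ℂ)
      = 1 + (-1) ^ n * (ε * I ^ (2 * ((κ : ℤ) + 1))) := by ring
  rw [e0]
  congr 2
  set S := √((1 + x / 2) * n + κ * x ^ 2 / 4) with hS
  have hS0 : 0 < S := Real.sqrt_pos.mpr (by positivity)
  have e1 : √(2 * π / (n * (2 / x + (2 / x) ^ 2) + κ)) = √(2 * π) * (x / 2) / S := by
    rw [show 2 * π / (n * (2 / x + (2 / x) ^ 2) + κ)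
        = 2 * π * (x / 2) ^ 2 / ((1 + x / 2) * n + κ * x ^ 2 / 4) by
      have : n * (2 / x + (2 / x) ^ 2) + κ ≠ 0 := by positivity
      have : (1 + x / 2) * n + κ * x ^ 2 / 4 ≠ 0 := by positivity
      field_simp
      ring, Real.sqrt_div' _ (by positivity), Real.sqrt_mul (by positivity),
      Real.sqrt_sq (by positivity)]
  have e2 : (N : ℝ) ^ ((((2 * ((κ : ℤ) + 1) : ℤ)) : ℝ) / 4)
      * Real.exp ((((2 * ((κ : ℤ) + 1) : ℤ)) : ℝ) / 4 * (x - Real.log N) - 2 * n / x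
        - (((2 * ((κ : ℤ) + 1) : ℤ)) : ℝ) / 2 + 1)
      = Real.exp (x / 2) ^ (κ + 1) * Real.exp (-(n * (2 / x) + κ)) := by
    rw [Real.rpow_def_of_pos hN, ← Real.exp_nat_mul, ← Real.exp_add, ← Real.exp_add]
    congr 1
    push_cast
    ring
  have e3 : (((2 * ((κ : ℤ) + 1) : ℤ)) : ℝ) / 2 - 1 = κ := by
    push_cast
    ring
  rw [e3, ← hS, laplaceLeading, e1]
  calc _ = √(2 * π) / 2 ^ (n + 1) * (x ^ (n + 1) / S)
        * ((N : ℝ) ^ ((((2 * ((κ : ℤ) + 1) : ℤ)) : ℝ) / 4)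
      * Real.exp ((((2 * ((κ : ℤ) + 1) : ℤ)) : ℝ) / 4 * (x - Real.log N) - 2 * n / x
        - (((2 * ((κ : ℤ) + 1) : ℤ)) : ℝ) / 2 + 1)) := by ring
    _ = _ := by
      rw [e2]
      have : (x / 2) ^ n = x ^ n / 2 ^ n := div_pow _ _ _
      rw [this, pow_succ, pow_succ]
      field_simp

/-! ### Expansions to all orders -/

/-- The factor `A n` $=1+(-1)^ni^k\epsilon$ may vanish for one parity of $n$. It is factored out of
both sides and never divided by. -/
theorem hasAllOrdersExpansion_of_saddle {N : ℕ} (κ : ℕ) {F A I₀ : ℕ → ℂ}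
    {L : ℕ → ℝ} {ε : ℂ} {b : ℕ → ℕ → ℝ}
    (hF : ∀ n, F n = A n * I₀ n)
    (hM : ∀ n : ℕ, 1 ≤ n → 0 < L n →
      leadingTerm N (2 * ((κ : ℤ) + 1)) ε n (L n) = laplaceLeading κ n (L n) * A n)
    (hlarge : ∀ᶠ n : ℕ in atTop, 1 ≤ n ∧ 2 ≤ L n ∧ Real.exp (L n / 2) ≤ n * √(N : ℝ))
    (hI : ∀ J : ℕ, ∃ C : ℝ, 0 ≤ C ∧ ∃ M : ℕ, ∀ᶠ n : ℕ in atTop,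
      ‖I₀ n - laplaceLeading κ n (L n) * ((1 + ∑ j ∈ Finset.Icc 1 J, b j n / (n : ℝ) ^ j : ℝ) : ℂ)‖
      ≤ laplaceLeading κ n (L n) * (C * (1 / n) ^ (J + 1) * L n ^ M)) :
    HasAllOrdersExpansion F (fun n => leadingTerm N (2 * ((κ : ℤ) + 1)) ε n (L n)) b := by
  intro J δ hδ
  obtain ⟨C, hC, M, h⟩ := hI J
  refine IsBigO.of_bound (C * ((2 / δ) ^ M * M.factorial * √(N : ℝ) ^ δ)) ?_
  filter_upwards [h, hlarge] with n hn ⟨hn1, hL2, hexp⟩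
  have hn0 : (0 : ℝ) < n := by exact_mod_cast hn1
  have hlead : 0 ≤ laplaceLeading κ n (L n) := by
    have : 0 < L n := by linarith
    rw [laplaceLeading]
    positivity
  have hpow := saddle_pow_le hδ hL2 hexp M
  rw [Real.mul_rpow hn0.le (Real.sqrt_nonneg _)] at hpow
  have hrpow : (n : ℝ) ^ (-((J : ℝ) + 1) + δ) = (1 / n) ^ (J + 1) * (n : ℝ) ^ δ := by
    rw [Real.rpow_add hn0, Real.rpow_neg hn0.le, one_div, inv_pow, ← Real.rpow_natCast]
    push_cast
    rfl
  have e : F n - leadingTerm N (2 * ((κ : ℤ) + 1)) ε n (L n)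
        * ((1 + ∑ j ∈ Finset.Icc 1 J, b j n / (n : ℝ) ^ j : ℝ) : ℂ)
      = A n * (I₀ n - laplaceLeading κ n (L n)
        * ((1 + ∑ j ∈ Finset.Icc 1 J, b j n / (n : ℝ) ^ j : ℝ) : ℂ)) := by
    rw [hF, hM n hn1 (by linarith)]
    ring
  rw [e, norm_mul, hM n hn1 (by linarith), norm_mul, hrpow, norm_mul, norm_mul,
    norm_norm, norm_norm, Real.norm_of_nonneg (show 0 ≤ (1 / (n : ℝ)) ^ (J + 1) * (n : ℝ) ^ δ by
      positivity), Complex.norm_real, Real.norm_eq_abs, abs_of_nonneg hlead]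
  calc _ ≤ ‖A n‖ * (laplaceLeading κ n (L n) * (C * (1 / n) ^ (J + 1) * L n ^ M)) := by gcongr
    _ ≤ ‖A n‖ * (laplaceLeading κ n (L n) * (C * (1 / n) ^ (J + 1)
        * ((2 / δ) ^ M * M.factorial * ((n : ℝ) ^ δ * √(N : ℝ) ^ δ)))) := by gcongr
    _ = _ := by ring

theorem HasAllOrdersExpansion.unit_mul {F M : ℕ → ℂ} {c : ℕ → ℕ → ℝ}
    (h : HasAllOrdersExpansion F M c) {u : ℕ → ℂ} (hu : ∀ n, ‖u n‖ = 1) :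
    HasAllOrdersExpansion (fun n => u n * F n) (fun n => u n * M n) c := by
  intro J δ hδ
  refine IsBigO.trans (IsBigO.of_norm_left ?_) (isBigO_refl _ _)
  have e : ∀ n, ‖u n * F n - u n * M n
        * ((1 + ∑ j ∈ Finset.Icc 1 J, c j n / (n : ℝ) ^ j : ℝ) : ℂ)‖
      = ‖F n - M n * ((1 + ∑ j ∈ Finset.Icc 1 J, c j n / (n : ℝ) ^ j : ℝ) : ℂ)‖ := fun n => by
    rw [mul_assoc, ← mul_sub, norm_mul, hu, one_mul]
  simp only [e, norm_mul, hu, one_mul]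
  exact (h J δ hδ).norm_left

/-! ### Derivatives of the completed `L`-function at the central point -/

section CentralDerivatives

variable {N : ℕ} [NeZero N]

theorem iteratedDeriv_completedL_center (κ : ℕ) (hk : 0 < 2 * ((κ : ℤ) + 1))
    (f : CuspFormGamma0 N (2 * ((κ : ℤ) + 1))) (hf : qCoeff f 1 = 1) {ε : ℂ}
    (hε : ∀ τ : ℍ, atkinLehner N (2 * ((κ : ℤ) + 1)) f τ = ε * f τ) (n : ℕ) :
    iteratedDeriv n (completedL hk f) (((2 * ((κ : ℤ) + 1) : ℤ) : ℂ) / 2)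
      = (1 + (-1) ^ n * (ε * I ^ (2 * ((κ : ℤ) + 1))))
        * ∫ t in Set.Ioi (1 : ℝ), ((Real.log t ^ n * t ^ κ : ℝ) : ℂ) * axis f t := by
  have hR := rapidDecay_axis f hf hε
  rw [completedL_eq_mellin, (hR.iteratedDeriv_mellin n).2,
    show (((2 * ((κ : ℤ) + 1) : ℤ) : ℂ) / 2) = (κ : ℂ) + 1 by push_cast; ring]
  refine mellin_log_fold hR κ n fun t ht => ?_
  rw [axis_inv f hε ht]
  congr 2

theorem iteratedDeriv_Xi {k : ℤ} (hk : 0 < k) (f : CuspFormGamma0 N k) (n : ℕ) :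
    iteratedDeriv n (Xi hk f) 0 = (-I) ^ n * iteratedDeriv n (completedL hk f) ((k : ℂ) / 2) := by
  have e : Xi hk f = fun z => (fun w => completedL hk f ((k : ℂ) / 2 + w)) (-I * z) := by
    funext z
    rw [Xi, sub_eq_add_neg, ← neg_mul]
  rw [e, iteratedDeriv_comp_mul_left' (fun w => completedL hk f ((k : ℂ) / 2 + w)) (-I) n]
  simp only [mul_zero]
  rw [iteratedDeriv_comp_const_add]
  simp only [add_zero]

/-- The Fourier expansion gives `f(iy/√N) = e^{-2πy/√N} (1 + O(e^{-2πy/√N}))`, so the integral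
expansion applies. -/
theorem exists_axis_integral_expansion (κ : ℕ) : ∃ b : ℕ → RatFunc ℚ, b 1 = firstCorrection ∧
    ∀ {k : ℤ} (f : CuspFormGamma0 N k), qCoeff f 1 = 1 → ∀ J : ℕ,
    ∃ C : ℝ, 0 ≤ C ∧ ∃ M : ℕ, ∀ (n : ℕ) (x : ℝ), 1 ≤ n → 2 ≤ x →
      1 / 2 * (2 * π / √(N : ℝ) * Real.exp (x / 2) - κ) * x = n →
      ‖(∫ t in Set.Ioi (1 : ℝ), ((Real.log t ^ n * t ^ κ : ℝ) : ℂ) * axis f t)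
        - laplaceLeading κ n x
          * ((1 + ∑ j ∈ Finset.Icc 1 J, (b j).eval (algebraMap ℚ ℝ) x / (n : ℝ) ^ j : ℝ) : ℂ)‖
      ≤ laplaceLeading κ n x * (C * (1 / n) ^ (J + 1) * x ^ M) := by
  obtain ⟨b, hb1, hb⟩ := exists_integral_expansion κ
  refine ⟨b, hb1, fun f hf J => ?_⟩
  set c := 2 * π / √(N : ℝ) with hc
  obtain ⟨C₀, hC₀, hC⟩ := axis_sub_exp_le f hf
  obtain ⟨C, hC', M, h⟩ := hb J C₀ hC₀
  refine ⟨C, hC', M, fun n x hn hx hs => ?_⟩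
  classical
  -- The extension by $0$ to $t\le0$ makes `g` measurable on the whole line; only its values on
  -- $(1,\infty)$ matter.
  set g : ℝ → ℂ := (Set.Ioi 0).piecewise (fun t => axis f t * Real.exp (c * t)) fun _ => 0 with hg
  have hgt : ∀ t : ℝ, 1 < t → g t = axis f t * Real.exp (c * t) := fun t ht =>
    Set.piecewise_eq_of_mem _ _ _ (zero_lt_one.trans ht)
  have hgm : Measurable g := by
    refine ContinuousOn.measurable_piecewise ((continuousOn_axis f).mul ?_) continuousOn_const
      measurableSet_Ioi
    fun_prop
  have hx0 : x ≠ 0 := by linarith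
  have key := h n x c g hn hx (by
    rw [← hs]
    field_simp
    ring) hgm fun y hy => by
      rw [hgt y hy]
      exact hC y hy.le
  have e : ∫ t in Set.Ioi (1 : ℝ), ((Real.log t ^ n * t ^ κ : ℝ) : ℂ) * axis f t
      = ∫ y in Set.Ioi (1 : ℝ), ((Real.log y ^ n * y ^ κ * Real.exp (-(c * y)) : ℝ) : ℂ) * g y := by
    refine setIntegral_congr_fun measurableSet_Ioi fun t ht => ?_
    have h1 : ((Real.exp (-(c * t)) : ℝ) : ℂ) * (Real.exp (c * t) : ℝ) = 1 := by
      rw [← Complex.ofReal_mul, ← Real.exp_add, neg_add_cancel, Real.exp_zero, Complex.ofReal_one]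
    rw [hgt t ht, Complex.ofReal_mul (Real.log t ^ n * t ^ κ)]
    linear_combination -((Real.log t ^ n * t ^ κ : ℝ) : ℂ) * axis f t * h1
  rw [e]
  exact key

end CentralDerivatives

end ModularAsymptotics

/-! ### The main theorem -/

theorem mainTheorem8 (N : ℕ) [NeZero N] (k : ℤ) (hk : 0 < k) (hk_even : Even k)
    (f : CuspFormGamma0 N k) (hf : IsNewform f) (hreal : ∀ n : ℕ, (qCoeff f n).im = 0)
    (ε : ℂ) (hε : ∀ τ : ℍ, atkinLehner N k f τ = ε * f τ) :
    (ε = 1 ∨ ε = -1) ∧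
    ∃ (L : ℕ → ℝ) (b : ℕ → RatFunc ℚ),
      (∀ n : ℕ, 1 ≤ n →
        0 < L n ∧ saddleFun N k (L n) = n ∧ ∀ x : ℝ, 0 < x → saddleFun N k x = n → x = L n) ∧
      ((fun n : ℕ => L n - 2 * Real.log (n * √(N : ℝ) / Real.log (n * √(N : ℝ))))
        =O[atTop] fun _ : ℕ => (1 : ℝ)) ∧
      b 1 = (RatFunc.X ^ 4 + 9 * RatFunc.X ^ 3 + 32 * RatFunc.X ^ 2 + 24 * RatFunc.X + 16)
        / (24 * (RatFunc.X + 2) ^ 3) ∧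
      HasAllOrdersExpansion
        (fun n => iteratedDeriv n (completedL hk f) ((k : ℂ) / 2))
        (fun n => leadingTerm N k ε n (L n))
        (fun j n => RatFunc.eval (algebraMap ℚ ℝ) (L n) (b j)) ∧
      HasAllOrdersExpansion
        (fun n => iteratedDeriv n (Xi hk f) 0)
        (fun n => (-I) ^ n * leadingTerm N k ε n (L n))
        (fun j n => RatFunc.eval (algebraMap ℚ ℝ) (L n) (b j)) := by
  refine ⟨eigenvalue_eq hk_even f hf.normalized hε, ?_⟩
  obtain ⟨κ, rfl⟩ : ∃ κ : ℕ, k = 2 * ((κ : ℤ) + 1) := by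
    obtain ⟨j, hj⟩ := hk_even
    exact ⟨(j - 1).toNat, by omega⟩
  have hs : 0 < √(N : ℝ) := sqrt_level_pos
  have hc : 0 < 2 * π / √(N : ℝ) := by positivity
  choose! L hL0 hL hLu using fun (n : ℕ) (hn : 1 ≤ n) => exists_saddle hc κ hn
  obtain ⟨b, hb1, hb⟩ := exists_axis_integral_expansion (N := N) κ
  have hLtop := tendsto_saddle hc κ hL0 hL
  have hlarge : ∀ᶠ n : ℕ in atTop, 1 ≤ n ∧ 2 ≤ L n ∧
      κ * √(N : ℝ) ≤ π * Real.exp (L n / 2) :=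
    (eventually_ge_atTop 1).and ((hLtop.eventually_ge_atTop 2).and
      (((Real.tendsto_exp_atTop.comp (hLtop.atTop_div_const two_pos)).const_mul_atTop
        Real.pi_pos).eventually_ge_atTop _))
  have hexpansion : HasAllOrdersExpansion
      (fun n => iteratedDeriv n (completedL hk f) (((2 * ((κ : ℤ) + 1) : ℤ) : ℂ) / 2))
      (fun n => leadingTerm N (2 * ((κ : ℤ) + 1)) ε n (L n))
      (fun j n => RatFunc.eval (algebraMap ℚ ℝ) (L n) (b j)) := by
    refine hasAllOrdersExpansion_of_saddle κ
      (fun n => iteratedDeriv_completedL_center κ hk f hf.normalized hε n)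
      (fun n hn hx => leadingTerm_eq κ ε hn hx) ?_ fun J => ?_
    · filter_upwards [hlarge] with n ⟨hn, h2, hκ⟩
      refine ⟨hn, h2, le_trans ?_ (saddle_bounds hs h2 (hL n hn) hκ).1⟩
      -- The lower saddle bound $\pi e^{L/2}\cdot L/2\le n\sqrt N$ then yields $e^{L/2}\le n\sqrt
      -- N$.
      have hp : 1 ≤ π * (L n / 2) := by nlinarith [Real.pi_gt_three]
      nlinarith [Real.exp_pos (L n / 2)]
    · obtain ⟨C, hC, M, h⟩ := hb f hf.normalized J
      refine ⟨C, hC, M, ?_⟩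
      filter_upwards [hlarge] with n ⟨hn, h2, _⟩
      exact h n (L n) hn h2 (hL n hn)
  refine ⟨L, b, fun n hn => ⟨hL0 n hn, ?_, fun x hx h => hLu n hn x hx ?_⟩, ?_, hb1,
    hexpansion, ?_⟩
  · rw [saddleFun_eq, hL n hn]
  · rwa [saddleFun_eq] at h
  · refine IsBigO.of_bound 4 ?_
    filter_upwards [hlarge] with n ⟨hn, h2, hκ⟩
    have h := saddle_bounds hs h2 (hL n hn) hκ
    have := abs_saddle_sub_log_le (l := L n / 2) (by linarith) h.1 h.2
    rw [mul_div_cancel₀ _ two_ne_zero, ← Real.norm_eq_abs] at this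
    rwa [norm_one, mul_one]
  · simp only [iteratedDeriv_Xi]
    exact hexpansion.unit_mul fun n => by rw [norm_pow, norm_neg, norm_I, one_pow]
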